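/- Let $k$ be a commutative ring, $I$ a finite set and $n\ge 0$ an integer. Let $Q=(Q_{ij})_{i,j\in I}$ be a matrix with entries in $k[u,u']$ such that $Q_{ii}=0$, $Q_{ij}$ is not a zero-divisor in $k[u,u']$ for $i\neq j$, and $Q_{ij}(u,u')=Q_{ji}(u',u)$. For $1\le i\le n-1$ let $s_i=(i,i+1)\in\mathfrak S_n$, and let $\mathfrak S_n$ act on $I^n$ by permuting the places. Let $\Psi_{I,n}$ be the quiver with vertex set $I^n$ and arrows $\tau_{i,v}:v\to s_i(v)$ ($1\le i\le n-1$, $v\in I^n$) and $x_{a,v}:v\to v$ ($1\le a\le n$, $v\in I^n$); write $1_v$ for the idempotent of its quiver algebra $k(\Psi_{I,n})$ attached to the vertex $v$. Let $H'_n(Q)$ be the quotient of $k(\Psi_{I,n})$ by the relations (for all indices and all $v\in I^n$) $$\tau_{i,s_i(v)}\tau_{i,v}=Q_{v_i,v_{i+1}}(x_{i,v},x_{i+1,v}),\qquad \tau_{i,s_j(v)}\tau_{j,v}=\tau_{j,s_i(v)}\tau_{i,v}\ \text{ if }|i-j|>1,$$ $$\tau_{i+1,s_is_{i+1}(v)}\tau_{i,s_{i+1}(v)}\tau_{i+1,v}=\tau_{i,s_{i+1}s_i(v)}\tau_{i+1,s_i(v)}\tau_{i,v}\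 \text{ if } v_i\neq v_{i+2}\text{ or }v_i=v_{i+1}=v_{i+2},$$ $$x_{a,v}x_{b,v}=x_{b,v}x_{a,v},\qquad \tau_{i,v}x_{a,v}-x_{s_i(a),s_i(v)}\tau_{i,v}=\begin{cases}-1_v&\text{if }a=i\text{ and }v_i=v_{i+1},\\ 1_v&\text{if }a=i+1\text{ and }v_i=v_{i+1},\\ 0&\text{otherwise.}\end{cases}$$ Let $H_n(Q)$ (the quiver Hecke algebra) be the quotient of $k(\Psi_{I,n})$ by these relations together with the relations $c_{i,v}=0$ for all $1\le i\le n-2$ and $v\in I^n$ with $v_i=v_{i+2}\neq v_{i+1}$, where $$c_{i,v}=\tau_{i+1,s_is_{i+1}(v)}\tau_{i,s_{i+1}(v)}\tau_{i+1,v}-\tau_{i,s_{i+1}s_i(v)}\tau_{i+1,s_i(v)}\tau_{i,v}-(x_{i+2,v}-x_{i,v})^{-1}\bigl(Q_{v_i,v_{i+1}}(x_{i+2,v},x_{i+1,v})-Q_{v_i,v_{i+1}}(x_{i,v},x_{i+1,v})\bigr)$$ (the last term is a polynomial in $x_{i,v},x_{i+1,v},x_{i+2,v}$). Let $k[x_1,\dots,x_n]$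 act on $H'_n(Q)$ by left multiplication through $x_a\mapsto\sum_{v\in I^n}x_{a,v}$. Call $a\in H'_n(Q)$ a polynomial-torsion element if there is $P\in k[x_1,\dots,x_n]$, not a zero-divisor in $k[x_1,\dots,x_n]$, such that $Pa=0$. Then: 1. The canonical morphism of $k$-algebras $H'_n(Q)\to H_n(Q)$ is surjective, and its kernel is exactly the set of polynomial-torsion elements of $H'_n(Q)$. 2. For all $1\le i\le n-2$ and $v\in I^n$ with $v_i=v_{i+2}\neq v_{i+1}$, the image of $c_{i,v}$ in $H'_n(Q)$ is a polynomial-torsion element; that is, the extra cubic relations follow from the other relations modulo polynomial torsion. 3. The polynomial-torsion elements form a two-sided ideal $J$ of $H'_n(Q)$, and the canonical morphism induces an isomorphism of $k$-algebras $H'_n(Q)/J\cong H_n(Q)$. -/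

import Mathlib

open MvPolynomial

noncomputable section

namespace QuiverHecke

universe u w

/-! ### Quotients of algebras by relations -/

section Presented

variable (k : Type u) [CommRing k] {A : Type w} [Ring A] [Algebra k A] (r : A → A → Prop)

/-- The quotient of an algebra by the two-sided ideal generated by all `a - b` with `r a b`. -/
def Presented {A : Type w} [Ring A] (r : A → A → Prop) : Type w := RingQuot r

instance : Ring (Presented r) := inferInstanceAs (Ring (RingQuot r))

instance : Algebra k (Presented r) := inferInstanceAs (Algebra k (RingQuot r))

/-- The quotient map. -/
def Presented.mk : A →ₐ[k] Presented r := RingQuot.mkAlgHom k r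

variable {k r}

theorem Presented.mk_rel {a b : A} (h : r a b) :
    Presented.mk k r a = Presented.mk k r b := RingQuot.mkAlgHom_rel k h

theorem Presented.mk_surjective : Function.Surjective (Presented.mk k r) :=
  RingQuot.mkAlgHom_surjective k r

/-- The universal property of the quotient. -/
def Presented.lift {B : Type*} [Ring B] [Algebra k B] (f : A →ₐ[k] B)
    (h : ∀ ⦃a b : A⦄, r a b → f a = f b) : Presented r →ₐ[k] B :=
  RingQuot.liftAlgHom k ⟨f, h⟩

theorem Presented.lift_mk {B : Type*} [Ring B] [Algebra k B] (f : A →ₐ[k] B)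
    (h : ∀ ⦃a b : A⦄, r a b → f a = f b) (a : A) :
    Presented.lift f h (Presented.mk k r a) = f a :=
  RingQuot.liftAlgHom_mkAlgHom_apply k f h a

end Presented

/-! ### Quiver algebras -/

/-- A quiver with vertex set `V` and arrow set `E`: each arrow has a source and a target. -/
structure ArrowQuiver (V E : Type*) where
  src : E → V
  tgt : E → V

section QuiverAlgebra

variable (k : Type u) [CommRing k] {V E : Type w} [Fintype V] [DecidableEq V]

/-- The defining relations of the quiver algebra `k(Γ)`, on the free algebra generated by the
vertices and the arrows: `s a = δ_{tgt a, s} a`, `a s = δ_{src a, s} a`, `s s' = δ_{s, s'} s` and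
`1 = ∑ t`. -/
inductive PathRel (Γ : ArrowQuiver V E) : FreeAlgebra k (V ⊕ E) → FreeAlgebra k (V ⊕ E) → Prop
  | vertex_mul_arrow (s : V) (a : E) :
      PathRel Γ (FreeAlgebra.ι k (Sum.inl s) * FreeAlgebra.ι k (Sum.inr a))
        (if Γ.tgt a = s then FreeAlgebra.ι k (Sum.inr a) else 0)
  | arrow_mul_vertex (s : V) (a : E) :
      PathRel Γ (FreeAlgebra.ι k (Sum.inr a) * FreeAlgebra.ι k (Sum.inl s))
        (if Γ.src a = s then FreeAlgebra.ι k (Sum.inr a) else 0)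
  | vertex_mul_vertex (s t : V) :
      PathRel Γ (FreeAlgebra.ι k (Sum.inl s) * FreeAlgebra.ι k (Sum.inl t))
        (if s = t then FreeAlgebra.ι k (Sum.inl s) else 0)
  | one : PathRel Γ 1 (∑ t : V, FreeAlgebra.ι k (Sum.inl t))

/-- The quiver algebra `k(Γ)`. -/
abbrev PathAlgebra (Γ : ArrowQuiver V E) : Type (max u w) := Presented (PathRel k Γ)

/-- The idempotent of `k(Γ)` attached to a vertex. -/
def PathAlgebra.vertex (Γ : ArrowQuiver V E) (s : V) : PathAlgebra k Γ :=
  Presented.mk k (PathRel k Γ) (FreeAlgebra.ι k (Sum.inl s))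

/-- The generator of `k(Γ)` attached to an arrow. -/
def PathAlgebra.arrow (Γ : ArrowQuiver V E) (a : E) : PathAlgebra k Γ :=
  Presented.mk k (PathRel k Γ) (FreeAlgebra.ι k (Sum.inr a))

variable {Γ : ArrowQuiver V E}

theorem PathAlgebra.arrow_mul_src (a : E) :
    arrow k Γ a * vertex k Γ (Γ.src a) = arrow k Γ a := by
  rw [arrow, vertex, ← map_mul, Presented.mk_rel (.arrow_mul_vertex _ a), if_pos rfl]

theorem PathAlgebra.vertex_mul_arrow_of_ne {a : E} {s : V} (h : Γ.tgt a ≠ s) :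
    vertex k Γ s * arrow k Γ a = 0 := by
  rw [arrow, vertex, ← map_mul, Presented.mk_rel (.vertex_mul_arrow s a), if_neg h, map_zero]

end QuiverAlgebra

/-! ### The quiver `Ψ_{I,n}`

Positions `1, …, n` are the elements of `Fin n`, and the indices `1, …, n - 1` of the simple
transpositions are the elements of `Fin (n - 1)`. -/

section Psi

variable {n : ℕ}

/-- The position `i` moved by `s_i`. -/
def lo (i : Fin (n - 1)) : Fin n := ⟨i.val, by omega⟩

/-- The position `i + 1` moved by `s_i`. -/
def hi (i : Fin (n - 1)) : Fin n := ⟨i.val + 1, by omega⟩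

/-- The simple transposition `s_i = (i, i + 1)`. -/
def sperm (i : Fin (n - 1)) : Equiv.Perm (Fin n) := Equiv.swap (lo i) (hi i)

/-- The action of `s_i` on `I^n` by place permutation. -/
def sact {I : Type w} (i : Fin (n - 1)) (v : Fin n → I) : Fin n → I := fun a => v (sperm i a)

/-- The arrows of `Ψ_{I,n}`. -/
inductive PsiArrow (I : Type w) (n : ℕ) : Type w
  | tau (i : Fin (n - 1)) (v : Fin n → I)
  | x (a : Fin n) (v : Fin n → I)

/-- The quiver `Ψ_{I,n}`: vertex set `I^n`, arrows `τ_{i,v} : v → s_i(v)` and `x_{a,v} : v → v`. -/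
def Psi (I : Type w) (n : ℕ) : ArrowQuiver (Fin n → I) (PsiArrow I n) where
  src
    | .tau _ v => v
    | .x _ v => v
  tgt
    | .tau i v => sact i v
    | .x _ v => v

end Psi

section Algebras

variable (k : Type u) [CommRing k] (I : Type w) [Fintype I] [DecidableEq I] (n : ℕ)

/-- The quiver algebra of `Ψ_{I,n}`, before any of the Hecke-type relations are imposed. -/
abbrev FreePsi : Type (max u w) := PathAlgebra k (Psi I n)

variable {I n}

/-- The idempotent `1_v`. -/
def e (v : Fin n → I) : FreePsi k I n := PathAlgebra.vertex k (Psi I n) v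

/-- The arrow `τ_{i,v}`. -/
def τ (i : Fin (n - 1)) (v : Fin n → I) : FreePsi k I n :=
  PathAlgebra.arrow k (Psi I n) (.tau i v)

/-- The arrow `x_{a,v}`. -/
def x (a : Fin n) (v : Fin n → I) : FreePsi k I n := PathAlgebra.arrow k (Psi I n) (.x a v)

variable {k}

/-- The element `F(x_{1,v}, …, x_{n,v})` of `1_v k(Ψ) 1_v`, for a polynomial `F`. The `x_{a,v}` do
not commute before the relations are imposed, so each monomial is written in increasing order of
the variables. -/
def polyAt (v : Fin n → I) (F : MvPolynomial (Fin n) k) : FreePsi k I n :=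
  ∑ m ∈ F.support, F.coeff m • ((List.ofFn fun a => x k a v ^ m a).prod * e k v)

/-- `q(x_a, x_b)` as a polynomial in `x_1, …, x_n`, for `q ∈ k[u, u']`. -/
def subst (a b : Fin n) (q : MvPolynomial (Fin 2) k) : MvPolynomial (Fin n) k :=
  aeval ![X a, X b] q

/-- The polynomial `(x_c - x_a)⁻¹ (q(x_c, x_b) - q(x_a, x_b))`, computed on each monomial by
`(x_c ^ d - x_a ^ d) / (x_c - x_a) = ∑_{t < d} x_c ^ t x_a ^ (d - 1 - t)`. -/
def divDiff (a b c : Fin n) (q : MvPolynomial (Fin 2) k) : MvPolynomial (Fin n) k :=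
  ∑ m ∈ q.support, C (q.coeff m) *
    ((∑ t ∈ Finset.range (m 0), X c ^ t * X a ^ (m 0 - 1 - t)) * X b ^ m 1)

theorem subst_eq_sum (a b : Fin n) (q : MvPolynomial (Fin 2) k) :
    subst a b q = ∑ m ∈ q.support, C (q.coeff m) * (X a ^ m 0 * X b ^ m 1) := by
  rw [subst, aeval_def, eval₂_eq']
  simp [Fin.prod_univ_two, algebraMap_eq]

/-- `divDiff` is the quotient it is meant to be. -/
theorem sub_mul_divDiff (a b c : Fin n) (q : MvPolynomial (Fin 2) k) :
    (X c - X a) * divDiff a b c q = subst c b q - subst a b q := by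
  rw [subst_eq_sum, subst_eq_sum, divDiff, Finset.mul_sum, ← Finset.sum_sub_distrib]
  refine Finset.sum_congr rfl fun m _ => ?_
  have h := geom_sum₂_mul (X c : MvPolynomial (Fin n) k) (X a) (m 0)
  linear_combination C (q.coeff m) * X b ^ m 1 * h

/-- The relations `R'_Q`, as equations `lhs = rhs` in `k(Ψ_{I,n})`. -/
inductive BasicRel (Q : I → I → MvPolynomial (Fin 2) k) : FreePsi k I n → FreePsi k I n → Prop
  | tau_sq (i : Fin (n - 1)) (v : Fin n → I) :
      BasicRel Q (τ k i (sact i v) * τ k i v)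
        (polyAt v (subst (lo i) (hi i) (Q (v (lo i)) (v (hi i)))))
  | tau_comm (i j : Fin (n - 1)) (v : Fin n → I) (hij : i.val + 1 < j.val ∨ j.val + 1 < i.val) :
      BasicRel Q (τ k i (sact j v) * τ k j v) (τ k j (sact i v) * τ k i v)
  | braid (i j : Fin (n - 1)) (hij : j.val = i.val + 1) (v : Fin n → I)
      (hv : v (lo i) ≠ v (hi j) ∨ (v (lo i) = v (hi i) ∧ v (hi i) = v (hi j))) :
      BasicRel Q (τ k j (sact i (sact j v)) * τ k i (sact j v) * τ k j v)
        (τ k i (sact j (sact i v)) * τ k j (sact i v) * τ k i v)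
  | x_comm (a b : Fin n) (v : Fin n → I) :
      BasicRel Q (x k a v * x k b v) (x k b v * x k a v)
  | tau_x (i : Fin (n - 1)) (a : Fin n) (v : Fin n → I) :
      BasicRel Q (τ k i v * x k a v - x k (sperm i a) (sact i v) * τ k i v)
        (if a = lo i ∧ v (lo i) = v (hi i) then -e k v
          else if a = hi i ∧ v (lo i) = v (hi i) then e k v
          else 0)

/-- The left-hand side minus the right-hand side of the extra cubic relation at positions
`i, i + 1, i + 2` (here `j` stands for `i + 1`, so that `hi i = lo j` is the position `i + 1` and
`hi j` is the position `i + 2`). -/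
def cubicDefect (Q : I → I → MvPolynomial (Fin 2) k) (i j : Fin (n - 1)) (v : Fin n → I) :
    FreePsi k I n :=
  τ k j (sact i (sact j v)) * τ k i (sact j v) * τ k j v
    - τ k i (sact j (sact i v)) * τ k j (sact i v) * τ k i v
    - polyAt v (divDiff (lo i) (hi i) (hi j) (Q (v (lo i)) (v (hi i))))

/-- The relations `R_Q`: those of `R'_Q`, and the cubic relation for `v_i = v_{i+2} ≠ v_{i+1}`. -/
inductive FullRel (Q : I → I → MvPolynomial (Fin 2) k) : FreePsi k I n → FreePsi k I n → Prop
  | basic {a b : FreePsi k I n} (h : BasicRel Q a b) : FullRel Q a b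
  | cubic (i j : Fin (n - 1)) (hij : j.val = i.val + 1) (v : Fin n → I)
      (hv : v (lo i) = v (hi j)) (hv' : v (hi i) ≠ v (lo i)) :
      FullRel Q (cubicDefect Q i j v) 0

variable (n)

/-- The algebra `H'_n(Q)`. -/
abbrev HeckePre (Q : I → I → MvPolynomial (Fin 2) k) : Type (max u w) :=
  Presented (BasicRel (n := n) Q)

/-- The quiver Hecke algebra `H_n(Q)`. -/
abbrev Hecke (Q : I → I → MvPolynomial (Fin 2) k) : Type (max u w) :=
  Presented (FullRel (n := n) Q)

/-- The quotient map `k(Ψ_{I,n}) → H'_n(Q)`. -/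
def mkPre (Q : I → I → MvPolynomial (Fin 2) k) : FreePsi k I n →ₐ[k] HeckePre n Q :=
  Presented.mk k (BasicRel (n := n) Q)

/-- The quotient map `k(Ψ_{I,n}) → H_n(Q)`. -/
def mkHecke (Q : I → I → MvPolynomial (Fin 2) k) : FreePsi k I n →ₐ[k] Hecke n Q :=
  Presented.mk k (FullRel (n := n) Q)

/-- The canonical morphism `H'_n(Q) → H_n(Q)`. -/
def canonicalMap (Q : I → I → MvPolynomial (Fin 2) k) : HeckePre n Q →ₐ[k] Hecke n Q :=
  Presented.lift (mkHecke n Q) fun _ _ h => Presented.mk_rel (FullRel.basic h)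

theorem canonicalMap_mkPre (Q : I → I → MvPolynomial (Fin 2) k) (a : FreePsi k I n) :
    canonicalMap n Q (mkPre n Q a) = mkHecke n Q a :=
  Presented.lift_mk _ _ a

/-! ### The action of `k[x_1, …, x_n]` -/

variable {n}

/-- The element `x_a = ∑_v x_{a,v}` of `H'_n(Q)`. -/
def xPre (Q : I → I → MvPolynomial (Fin 2) k) (a : Fin n) : HeckePre n Q :=
  ∑ v : Fin n → I, mkPre n Q (x k a v)

theorem x_mul_x_of_ne (a b : Fin n) {v v' : Fin n → I} (h : v ≠ v') :
    x k a v * x k b v' = 0 := by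
  have h1 : x k a v * e k v = x k a v := PathAlgebra.arrow_mul_src k _
  have h2 : e k v * x k b v' = 0 := PathAlgebra.vertex_mul_arrow_of_ne k h.symm
  rw [← h1, mul_assoc, h2, mul_zero]

theorem xPre_mul_comm (Q : I → I → MvPolynomial (Fin 2) k) (a b : Fin n) :
    xPre Q a * xPre Q b = xPre Q b * xPre Q a := by
  have key : ∀ a b : Fin n, xPre Q a * xPre Q b = ∑ v, mkPre n Q (x k a v * x k b v) := by
    intro a b
    rw [xPre, xPre, Finset.sum_mul_sum]
    refine Finset.sum_congr rfl fun v _ => ?_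
    rw [Finset.sum_eq_single v]
    · rw [map_mul]
    · intro v' _ h
      rw [← map_mul, x_mul_x_of_ne a b h.symm, map_zero]
    · simp
  rw [key, key]
  exact Finset.sum_congr rfl fun v _ => Presented.mk_rel (BasicRel.x_comm a b v)

/-- The morphism `k[x_1, …, x_n] → H'_n(Q)`, `x_a ↦ ∑_v x_{a,v}`. -/
def polyPre (Q : I → I → MvPolynomial (Fin 2) k) :
    MvPolynomial (Fin n) k →ₐ[k] HeckePre n Q :=
  have hcomm : IsMulCommutative (Algebra.adjoin k (Set.range (xPre (n := n) Q))) :=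
    Algebra.isMulCommutative_adjoin k (by
      rintro _ ⟨a, rfl⟩ _ ⟨b, rfl⟩
      exact xPre_mul_comm Q a b)
  letI : CommRing (Algebra.adjoin k (Set.range (xPre (n := n) Q))) :=
    { (Algebra.adjoin k (Set.range (xPre (n := n) Q))).toRing with
      mul_comm := hcomm.is_comm.comm }
  (Algebra.adjoin k (Set.range (xPre (n := n) Q))).val.comp
    (MvPolynomial.aeval fun a => ⟨xPre Q a, Algebra.subset_adjoin ⟨a, rfl⟩⟩)

theorem polyPre_X (Q : I → I → MvPolynomial (Fin 2) k) (a : Fin n) :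
    polyPre Q (X a) = xPre Q a := by
  simp [polyPre]

/-- The polynomial-torsion elements of `H'_n(Q)`: those killed by left multiplication by some
polynomial in `x_1, …, x_n` that is not a zero-divisor. -/
def IsPolyTorsion (Q : I → I → MvPolynomial (Fin 2) k) (a : HeckePre n Q) : Prop :=
  ∃ P ∈ nonZeroDivisors (MvPolynomial (Fin n) k), polyPre Q P * a = 0

end Algebras

end QuiverHecke

end

noncomputable section

namespace QuiverHecke

universe u w

/-! ### Relations in `H'_n(Q)` -/

section PathAlgebra

variable {k : Type u} [CommRing k] {V E : Type w} [Fintype V] [DecidableEq V]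
  {Γ : ArrowQuiver V E}

/-! The two algebras have the same generators, so the canonical map is onto; what has to be found is
its kernel. Two facts determine it.

The extra cubic relations hold up to torsion. In $H'_n(Q)$ one already has $\tau_i c_{i,v}=0$: the
braid relation is available at $s_{i+1}(v)$, whose outer colors differ, and together with the
quadratic relations it turns $\tau_i c_{i,v}$ into an instance of the rule for moving a polynomial
through $\tau_{i+1}$ (`τPre_mul_mkPre_cubicDefect`). Multiplying by $\tau_i$ once more shows that
the regular polynomial $Q_{v_i,v_{i+1}}(x_i,x_{i+1})$ kills $c_{i,v}$. Torsion is a two-sided ideal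
$J$, because a regular polynomial divides the product of its conjugates under $\mathfrak S_n$, which
is regular and central (`commute_polyPre_of_symmetric`). So $H'_n(Q)\to H'_n(Q)/J$ factors through
$H_n(Q)$, and the kernel lies in $J$.

Conversely, $H_n(Q)$ has no torsion (`eq_zero_of_polyPre_mul_eq_zero`), so torsion dies in it. The
relations of Hecke type let $n!$ elements span $H_n(Q)$ on the left over the polynomials and
idempotents (`IsHeckeLike.exists_spanning`). For each color vector $c$, the algebra acts on
functions on $\mathfrak S_n$ with values in the total fraction ring $K$ of $k[x_1,\dots,x_n]$, the
$x_a$ acting diagonally. The functionals $F\mapsto (aF)(1)$ span the dual over $K$, which is free of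
rank $n!$; hence those of the $n!$ spanning elements are independent
(`WeightData.linearIndependent_row`). If $f$ is regular and $fa=0$, independence forces every
coefficient of $a$ to vanish, one color vector at a time. -/

theorem PathAlgebra.arrow_mul_vertex (a : E) (s : V) :
    arrow k Γ a * vertex k Γ s = if Γ.src a = s then arrow k Γ a else 0 := by
  rw [arrow, vertex, ← map_mul, Presented.mk_rel (.arrow_mul_vertex s a)]
  split_ifs <;> simp

theorem PathAlgebra.vertex_mul_arrow (a : E) (s : V) :
    vertex k Γ s * arrow k Γ a = if Γ.tgt a = s then arrow k Γ a else 0 := by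
  rw [arrow, vertex, ← map_mul, Presented.mk_rel (.vertex_mul_arrow s a)]
  split_ifs <;> simp

theorem PathAlgebra.vertex_mul_vertex (s t : V) :
    vertex k Γ s * vertex k Γ t = if s = t then vertex k Γ s else 0 := by
  rw [vertex, vertex, ← map_mul, Presented.mk_rel (.vertex_mul_vertex s t)]
  split_ifs <;> simp

theorem PathAlgebra.sum_vertex : ∑ t, vertex k Γ t = 1 := by
  simp only [vertex]
  rw [← map_sum, ← Presented.mk_rel .one, map_one]

/-- The universal property of the quiver algebra. -/
def PathAlgebra.lift {B : Type*} [Ring B] [Algebra k B] (f : V → B) (g : E → B)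
    (hf : ∀ s t, f s * f t = if s = t then f s else 0) (hsum : ∑ t, f t = 1)
    (htgt : ∀ a, f (Γ.tgt a) * g a = g a) (hsrc : ∀ a, g a * f (Γ.src a) = g a) :
    PathAlgebra k Γ →ₐ[k] B :=
  Presented.lift (FreeAlgebra.lift k (Sum.elim f g)) (by
    rintro _ _ (⟨s, a⟩ | ⟨s, a⟩ | ⟨s, t⟩ | _)
    · rw [map_mul, FreeAlgebra.lift_ι_apply, FreeAlgebra.lift_ι_apply, Sum.elim_inl, Sum.elim_inr]
      split_ifs with h
      · rw [FreeAlgebra.lift_ι_apply, ← h, htgt, Sum.elim_inr]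
      · rw [← htgt, ← mul_assoc, hf, if_neg (Ne.symm h), zero_mul, map_zero]
    · rw [map_mul, FreeAlgebra.lift_ι_apply, FreeAlgebra.lift_ι_apply, Sum.elim_inl, Sum.elim_inr]
      split_ifs with h
      · rw [FreeAlgebra.lift_ι_apply, ← h, hsrc, Sum.elim_inr]
      · rw [← hsrc, mul_assoc, hf, if_neg h, mul_zero, map_zero]
    · rw [map_mul, FreeAlgebra.lift_ι_apply, FreeAlgebra.lift_ι_apply, Sum.elim_inl, Sum.elim_inl,
        hf]
      split_ifs <;> simp
    · simp [hsum])

section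

variable {B : Type*} [Ring B] [Algebra k B] (f : V → B) (g : E → B)
    (hf : ∀ s t, f s * f t = if s = t then f s else 0) (hsum : ∑ t, f t = 1)
    (htgt : ∀ a, f (Γ.tgt a) * g a = g a) (hsrc : ∀ a, g a * f (Γ.src a) = g a)

theorem PathAlgebra.lift_vertex (s : V) :
    PathAlgebra.lift (k := k) f g hf hsum htgt hsrc (vertex k Γ s) = f s :=
  (Presented.lift_mk _ _ _).trans (FreeAlgebra.lift_ι_apply _ _)

theorem PathAlgebra.lift_arrow (a : E) :
    PathAlgebra.lift (k := k) f g hf hsum htgt hsrc (arrow k Γ a) = g a :=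
  (Presented.lift_mk _ _ _).trans (FreeAlgebra.lift_ι_apply _ _)

end

end PathAlgebra

/-! ### Simple transpositions acting on positions and on color vectors. -/

section Positions

variable {n : ℕ} {I : Type w}

@[simp] theorem sperm_lo (i : Fin (n - 1)) : sperm i (lo i) = hi i := Equiv.swap_apply_left _ _

@[simp] theorem sperm_hi (i : Fin (n - 1)) : sperm i (hi i) = lo i := Equiv.swap_apply_right _ _

theorem sperm_of_ne (i : Fin (n - 1)) {a : Fin n} (h : a ≠ lo i) (h' : a ≠ hi i) :
    sperm i a = a := Equiv.swap_apply_of_ne_of_ne h h'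

@[simp] theorem sperm_sperm (i : Fin (n - 1)) (a : Fin n) : sperm i (sperm i a) = a := by
  simp [sperm]

@[simp] theorem sperm_mul_self (i : Fin (n - 1)) : sperm i * sperm i = 1 := Equiv.swap_mul_self _ _

theorem lo_ne_hi (i : Fin (n - 1)) : lo i ≠ hi i := by
  simp [lo, hi, Fin.ext_iff]

theorem hi_eq_lo {i j : Fin (n - 1)} (hij : j.val = i.val + 1) : hi i = lo j := by
  simp [lo, hi, hij]

theorem lo_ne_hi_succ {i j : Fin (n - 1)} (hij : j.val = i.val + 1) : lo i ≠ hi j := by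
  simp [lo, hi, Fin.ext_iff]; omega

@[simp] theorem sact_sact (i : Fin (n - 1)) (v : Fin n → I) : sact i (sact i v) = v := by
  funext a; simp [sact]

theorem sact_eq_iff {i : Fin (n - 1)} {v w : Fin n → I} : sact i v = w ↔ v = sact i w := by
  constructor <;> rintro rfl <;> simp

theorem sact_eq_self {i : Fin (n - 1)} {v : Fin n → I} (h : v (lo i) = v (hi i)) :
    sact i v = v := by
  funext a
  by_cases h1 : a = lo i
  · subst h1; simp [sact, h]
  by_cases h2 : a = hi i
  · subst h2; simp [sact, h]
  simp [sact, sperm_of_ne i h1 h2]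

end Positions

/-! ### Regular elements of polynomial rings. -/

section Regular

variable {σ ρ : Type*} {R : Type*} [CommRing R]

/-- After splitting off the variables outside the range of `f`, the renamed polynomial is a constant
`C q`, and multiplication by it acts coefficient by coefficient as multiplication by `q`. -/
theorem rename_mem_nonZeroDivisors {f : σ → ρ} (hf : Function.Injective f)
    {q : MvPolynomial σ R} (hq : q ∈ nonZeroDivisors (MvPolynomial σ R)) :
    rename f q ∈ nonZeroDivisors (MvPolynomial ρ R) := by
  classical
  let g : (↑(Set.range f)ᶜ ⊕ σ) ≃ ρ := (Equiv.sumComm _ _).trans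
    ((Equiv.sumCongr (Equiv.ofInjective f hf) (Equiv.refl _)).trans
      (Equiv.Set.sumCompl (Set.range f)))
  have hg : (g.symm ∘ f : σ → _) = Sum.inr := by
    funext s
    rw [Function.comp_apply, Equiv.symm_apply_eq]
    simp [g]
  let A := (renameEquiv R g.symm).trans (sumAlgEquiv R _ _)
  have hA : A (rename f q) = C q := by
    have := AlgHom.congr_fun (sumAlgEquiv_comp_rename_inr R ↑(Set.range f)ᶜ σ) q
    simpa [A, rename_rename, hg] using this
  rw [mem_nonZeroDivisors_iff_right] at hq ⊢
  intro p hp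
  have h : A p * C q = 0 := by rw [← hA, ← map_mul, hp, map_zero]
  rw [← map_eq_zero_iff A A.injective]
  ext1 m
  rw [coeff_zero]
  refine hq _ ?_
  rw [mul_comm, ← coeff_C_mul, mul_comm, h, coeff_zero]

/-- The change of variables $X_a\mapsto X_a+X_b$ is injective and carries $X_a-X_b$ to the regular
element $X_a$. -/
theorem X_sub_X_mem_nonZeroDivisors {a b : σ} (h : a ≠ b) :
    (X a - X b : MvPolynomial σ R) ∈ nonZeroDivisors (MvPolynomial σ R) := by
  classical
  let f : MvPolynomial σ R →ₐ[R] MvPolynomial σ R :=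
    aeval fun c => if c = a then X a + X b else X c
  let g : MvPolynomial σ R →ₐ[R] MvPolynomial σ R :=
    aeval fun c => if c = a then X a - X b else X c
  have hgf : g.comp f = AlgHom.id R _ := by
    refine algHom_ext fun c => ?_
    by_cases hc : c = a
    · subst hc; simp [f, g, h.symm]
    · simp [f, g, hc]
  rw [mem_nonZeroDivisors_iff_right]
  intro p hp
  have hfp : f p * X a = 0 := by
    have := congrArg f hp
    simpa [f, h.symm] using this
  have h0 : f p = 0 := by simpa using hfp
  have := AlgHom.congr_fun hgf p
  simpa [h0] using this.symm

end Regular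

/-! ### Idempotents, arrows and ordered monomials in the quiver algebra. -/

section FreePsi

variable {k : Type u} [CommRing k] {I : Type w} [Fintype I] [DecidableEq I] {n : ℕ}

theorem e_mul_e (v w : Fin n → I) : e k v * e k w = if v = w then e k v else 0 :=
  PathAlgebra.vertex_mul_vertex v w

variable (k I n) in
theorem sum_e : ∑ v : Fin n → I, e k v = 1 := PathAlgebra.sum_vertex

theorem x_mul_e (a : Fin n) (v w : Fin n → I) :
    x k a v * e k w = if v = w then x k a v else 0 :=
  PathAlgebra.arrow_mul_vertex (Γ := Psi I n) (.x a v) w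

theorem e_mul_x (a : Fin n) (v w : Fin n → I) :
    e k w * x k a v = if v = w then x k a v else 0 :=
  PathAlgebra.vertex_mul_arrow (Γ := Psi I n) (.x a v) w

theorem τ_mul_e (i : Fin (n - 1)) (v w : Fin n → I) :
    τ k i v * e k w = if v = w then τ k i v else 0 :=
  PathAlgebra.arrow_mul_vertex (Γ := Psi I n) (.tau i v) w

theorem e_mul_τ (i : Fin (n - 1)) (v w : Fin n → I) :
    e k w * τ k i v = if sact i v = w then τ k i v else 0 :=
  PathAlgebra.vertex_mul_arrow (Γ := Psi I n) (.tau i v) w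

/-- The image of `polyAt v F` under a morphism for which the images of the `x_{a,v}` come from
a morphism from the polynomial algebra. -/
theorem map_polyAt {B : Type*} [Ring B] [Algebra k B] (g : FreePsi k I n →ₐ[k] B)
    (θ : MvPolynomial (Fin n) k →ₐ[k] B) (v : Fin n → I)
    (hθ : ∀ a, g (x k a v) = θ (X a) * g (e k v))
    (hc : ∀ a, Commute (g (e k v)) (θ (X a))) (F : MvPolynomial (Fin n) k) :
    g (polyAt v F) = θ F * g (e k v) := by
  have hee : g (e k v) * g (e k v) = g (e k v) := by rw [← map_mul, e_mul_e, if_pos rfl]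
  have hpow : ∀ a m, g (x k a v) ^ m * g (e k v) = θ (X a) ^ m * g (e k v) := by
    intro a m
    induction m with
    | zero => simp
    | succ m ih =>
      rw [pow_succ', mul_assoc, ih, hθ, mul_assoc, ← mul_assoc (g (e k v)),
        ((hc a).pow_right m).eq, mul_assoc, hee, ← mul_assoc, ← pow_succ']
  have hlist : ∀ (m : Fin n →₀ ℕ) (l : List (Fin n)),
      (l.map fun a => g (x k a v) ^ m a).prod * g (e k v)
        = (l.map fun a => θ (X a) ^ m a).prod * g (e k v) := by
    intro m l
    induction l with
    | nil => simp
    | cons a l ih =>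
      have hl : Commute (g (e k v)) (l.map fun a => θ (X a) ^ m a).prod := by
        refine Commute.list_prod_right _ _ fun b hb => ?_
        obtain ⟨a, -, rfl⟩ := List.mem_map.1 hb
        exact (hc a).pow_right _
      rw [List.map_cons, List.prod_cons, List.map_cons, List.prod_cons, mul_assoc, ih,
        ← hl.eq, ← mul_assoc, hpow, mul_assoc, hl.eq, mul_assoc]
  conv_rhs => rw [F.as_sum]
  rw [polyAt, map_sum, map_sum, Finset.sum_mul]
  refine Finset.sum_congr rfl fun m _ => ?_
  have hm : monomial m (F.coeff m)
      = F.coeff m • ((List.finRange n).map fun a => (X a : MvPolynomial (Fin n) k) ^ m a).prod := by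
    rw [← List.ofFn_eq_map, List.prod_ofFn, monomial_eq, smul_eq_C_mul,
      Finsupp.prod_fintype _ _ (by simp)]
  rw [hm, map_smul, map_smul, map_mul, map_list_prod, map_list_prod, List.ofFn_eq_map,
    List.map_map, List.map_map, smul_mul_assoc]
  congr 1
  have := hlist m (List.finRange n)
  simpa [Function.comp_def, map_pow] using this

end FreePsi

/-! ### The relations of $H'_n(Q)$ in terms of the global elements $\tau_i$, $x_a$ and the
idempotents. -/

section HeckePre

variable {k : Type u} [CommRing k] {I : Type w} [Fintype I] [DecidableEq I] {n : ℕ}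
  (Q : I → I → MvPolynomial (Fin 2) k)

/-- The idempotent `1_v` of `H'_n(Q)`. -/
def ePre (v : Fin n → I) : HeckePre n Q := mkPre n Q (e k v)

/-- The element `τ_i = ∑_v τ_{i,v}` of `H'_n(Q)`. -/
def τPre (i : Fin (n - 1)) : HeckePre n Q := ∑ v : Fin n → I, mkPre n Q (τ k i v)

variable {Q}

theorem ePre_mul_ePre (v w : Fin n → I) :
    ePre Q v * ePre Q w = if v = w then ePre Q v else 0 := by
  rw [ePre, ePre, ← map_mul, e_mul_e]; split_ifs <;> simp

@[simp] theorem ePre_mul_self (v : Fin n → I) : ePre Q v * ePre Q v = ePre Q v := by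
  simp [ePre_mul_ePre]

theorem sum_ePre : ∑ v : Fin n → I, ePre Q v = 1 := by
  simp only [ePre]
  rw [← map_sum, sum_e, map_one]

theorem τPre_mul_ePre (i : Fin (n - 1)) (v : Fin n → I) :
    τPre Q i * ePre Q v = mkPre n Q (τ k i v) := by
  simp only [τPre, ePre, Finset.sum_mul, ← map_mul, τ_mul_e, apply_ite (mkPre n Q), map_zero]
  simp

theorem ePre_mul_τPre (i : Fin (n - 1)) (v : Fin n → I) :
    ePre Q (sact i v) * τPre Q i = mkPre n Q (τ k i v) := by
  simp only [τPre, ePre, Finset.mul_sum, ← map_mul, e_mul_τ, apply_ite (mkPre n Q), map_zero,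
    sact_eq_iff, sact_sact]
  simp

theorem τPre_ePre_comm (i : Fin (n - 1)) (v : Fin n → I) :
    τPre Q i * ePre Q v = ePre Q (sact i v) * τPre Q i := by
  rw [τPre_mul_ePre, ePre_mul_τPre]

theorem xPre_mul_ePre (a : Fin n) (v : Fin n → I) :
    xPre Q a * ePre Q v = mkPre n Q (x k a v) := by
  simp only [xPre, ePre, Finset.sum_mul, ← map_mul, x_mul_e, apply_ite (mkPre n Q), map_zero]
  simp

theorem ePre_mul_xPre (a : Fin n) (v : Fin n → I) :
    ePre Q v * xPre Q a = mkPre n Q (x k a v) := by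
  simp only [xPre, ePre, Finset.mul_sum, ← map_mul, e_mul_x, apply_ite (mkPre n Q), map_zero]
  simp

theorem commute_ePre_polyPre (v : Fin n → I) (f : MvPolynomial (Fin n) k) :
    Commute (ePre Q v) (polyPre Q f) := by
  induction f using MvPolynomial.induction_on with
  | C c => rw [← algebraMap_eq, AlgHom.commutes]; exact Algebra.commute_algebraMap_right c _
  | add p q hp hq => rw [map_add]; exact hp.add_right hq
  | mul_X p a hp =>
    rw [map_mul, polyPre_X]
    exact hp.mul_right (by rw [Commute, SemiconjBy, ePre_mul_xPre, xPre_mul_ePre])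

theorem mkPre_polyAt (v : Fin n → I) (F : MvPolynomial (Fin n) k) :
    mkPre n Q (polyAt v F) = polyPre Q F * ePre Q v :=
  map_polyAt (mkPre n Q) (polyPre Q) v
    (fun a => by rw [polyPre_X]; exact (xPre_mul_ePre a v).symm)
    (fun _ => commute_ePre_polyPre v _) F

theorem τPre_mul_τPre_mul_ePre (i j : Fin (n - 1)) (v : Fin n → I) :
    mkPre n Q (τ k i (sact j v) * τ k j v) = τPre Q i * τPre Q j * ePre Q v := by
  rw [map_mul, ← τPre_mul_ePre, ← τPre_mul_ePre, mul_assoc, ← mul_assoc (ePre Q _),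
    ← τPre_ePre_comm, mul_assoc (τPre Q j), ePre_mul_self, mul_assoc]

theorem τPre_mul_τPre_mul_τPre_mul_ePre (i j l : Fin (n - 1)) (v : Fin n → I) :
    mkPre n Q (τ k i (sact j (sact l v)) * τ k j (sact l v) * τ k l v)
      = τPre Q i * τPre Q j * τPre Q l * ePre Q v := by
  rw [map_mul, τPre_mul_τPre_mul_ePre, ← τPre_mul_ePre, mul_assoc, ← mul_assoc (ePre Q _),
    ← τPre_ePre_comm, mul_assoc (τPre Q l), ePre_mul_self, mul_assoc (_ * _)]

theorem τPre_sq (i : Fin (n - 1)) (v : Fin n → I) :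
    τPre Q i * τPre Q i * ePre Q v
      = polyPre Q (subst (lo i) (hi i) (Q (v (lo i)) (v (hi i)))) * ePre Q v := by
  rw [← τPre_mul_τPre_mul_ePre, ← mkPre_polyAt]
  exact Presented.mk_rel (.tau_sq i v)

theorem ext_mul_ePre {a b : HeckePre n Q} (h : ∀ v, a * ePre Q v = b * ePre Q v) : a = b := by
  rw [← mul_one a, ← mul_one b, ← sum_ePre, Finset.mul_sum, Finset.mul_sum]
  exact Finset.sum_congr rfl fun v _ => h v

theorem τPre_comm (i j : Fin (n - 1)) (hij : i.val + 1 < j.val ∨ j.val + 1 < i.val) :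
    τPre Q i * τPre Q j = τPre Q j * τPre Q i := by
  refine ext_mul_ePre fun v => ?_
  rw [← τPre_mul_τPre_mul_ePre, ← τPre_mul_τPre_mul_ePre]
  exact Presented.mk_rel (.tau_comm i j v hij)

theorem τPre_braid {i j : Fin (n - 1)} (hij : j.val = i.val + 1) {v : Fin n → I}
    (hv : v (lo i) ≠ v (hi j) ∨ (v (lo i) = v (hi i) ∧ v (hi i) = v (hi j))) :
    τPre Q j * τPre Q i * τPre Q j * ePre Q v = τPre Q i * τPre Q j * τPre Q i * ePre Q v := by
  rw [← τPre_mul_τPre_mul_τPre_mul_ePre, ← τPre_mul_τPre_mul_τPre_mul_ePre]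
  exact Presented.mk_rel (.braid i j hij v hv)

theorem τPre_mul_xPre (i : Fin (n - 1)) (a : Fin n) (v : Fin n → I) :
    τPre Q i * xPre Q a * ePre Q v = xPre Q (sperm i a) * τPre Q i * ePre Q v
      + (if a = lo i ∧ v (lo i) = v (hi i) then -ePre Q v
          else if a = hi i ∧ v (lo i) = v (hi i) then ePre Q v else 0) := by
  rw [← sub_eq_iff_eq_add']
  have h := Presented.mk_rel (k := k) (BasicRel.tau_x (Q := Q) i a v)
  change mkPre n Q _ = mkPre n Q _ at h
  rw [map_sub, map_mul, map_mul, ← τPre_mul_ePre, ← xPre_mul_ePre, ← xPre_mul_ePre] at h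
  convert h using 1
  · rw [mul_assoc, xPre_mul_ePre, ← ePre_mul_xPre, mul_assoc (τPre Q i), ← mul_assoc (ePre Q v),
      ePre_mul_self, mul_assoc, mul_assoc (xPre Q _) (ePre Q _), τPre_ePre_comm,
      ← mul_assoc (ePre Q _), ePre_mul_self]
  · split_ifs <;> simp [ePre]

/-- Moving a polynomial through `τ_i`. -/
theorem τPre_mul_polyPre (i : Fin (n - 1)) (f : MvPolynomial (Fin n) k) (v : Fin n → I) :
    ∃ d, (X (hi i) - X (lo i)) * d = (if v (lo i) = v (hi i) then f - rename (sperm i) f else 0) ∧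
      τPre Q i * polyPre Q f * ePre Q v
        = polyPre Q (rename (sperm i) f) * τPre Q i * ePre Q v + polyPre Q d * ePre Q v := by
  induction f using MvPolynomial.induction_on with
  | C c =>
    refine ⟨0, by simp, ?_⟩
    rw [rename_C, map_zero, zero_mul, add_zero, ← algebraMap_eq, AlgHom.commutes,
      Algebra.commutes]
  | add p q hp hq =>
    obtain ⟨d, hd, h⟩ := hp
    obtain ⟨d', hd', h'⟩ := hq
    refine ⟨d + d', ?_, ?_⟩
    · rw [mul_add, hd, hd']; split_ifs <;> simp; ring
    · simp only [map_add, mul_add, add_mul, h, h']; abel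
  | mul_X f a hf =>
    obtain ⟨d, hd, h⟩ := hf
    -- The correction term for the single variable $x_a$; the one for $f x_a$ then follows from a
    -- twisted Leibniz rule.
    set c : MvPolynomial (Fin n) k := if a = lo i ∧ v (lo i) = v (hi i) then -1
          else if a = hi i ∧ v (lo i) = v (hi i) then 1 else 0 with hc
    have hx : τPre Q i * xPre Q a * ePre Q v
        = xPre Q (sperm i a) * τPre Q i * ePre Q v + polyPre Q c * ePre Q v := by
      rw [τPre_mul_xPre, hc]; split_ifs <;> simp
    have hcX : (X (hi i) - X (lo i)) * c
        = if v (lo i) = v (hi i) then X a - X (sperm i a) else 0 := by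
      rw [hc]
      by_cases hv : v (lo i) = v (hi i)
      · by_cases h1 : a = lo i
        · subst h1; simp [hv]
        by_cases h2 : a = hi i
        · subst h2; simp [hv, (lo_ne_hi i).symm]
        simp [hv, h1, h2, sperm_of_ne]
      · simp [hv]
    refine ⟨rename (sperm i) f * c + d * X a, ?_, ?_⟩
    · rw [mul_add, mul_left_comm, hcX, ← mul_assoc, hd, map_mul, rename_X]
      split_ifs
      · ring
      · simp
    · have key : τPre Q i * polyPre Q (f * X a) * ePre Q v
          = (τPre Q i * polyPre Q f * ePre Q v) * xPre Q a := by
        rw [map_mul, polyPre_X, mul_assoc _ (ePre Q v), ePre_mul_xPre, ← xPre_mul_ePre]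
        simp only [mul_assoc]
      rw [key, h, add_mul, mul_assoc _ (ePre Q v), ePre_mul_xPre, ← xPre_mul_ePre,
        mul_assoc (polyPre Q d), ePre_mul_xPre, ← xPre_mul_ePre, mul_assoc (polyPre Q _) (τPre Q i),
        ← mul_assoc (τPre Q i), hx, map_mul, rename_X, map_add, map_mul, map_mul, map_mul,
        polyPre_X, polyPre_X]
      simp only [mul_assoc, mul_add, add_mul, add_assoc]

end HeckePre

/-! ### Polynomial torsion in `H'_n(Q)` -/

section Subst

variable {k : Type u} [CommRing k] {n : ℕ}

theorem subst_eq_rename (a b : Fin n) (q : MvPolynomial (Fin 2) k) :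
    subst a b q = rename ![a, b] q := by
  rw [subst, rename_eq_aeval]
  congr 2
  funext c
  fin_cases c <;> rfl

theorem rename_subst (σ : Equiv.Perm (Fin n)) (a b : Fin n) (q : MvPolynomial (Fin 2) k) :
    rename σ (subst a b q) = subst (σ a) (σ b) q := by
  rw [subst_eq_rename, subst_eq_rename, rename_rename]
  congr 2
  funext c
  fin_cases c <;> rfl

theorem subst_rename_swap (a b : Fin n) (q : MvPolynomial (Fin 2) k) :
    subst a b (rename (Equiv.swap (0 : Fin 2) 1) q) = subst b a q := by
  rw [subst_eq_rename, subst_eq_rename, rename_rename]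
  congr 2
  funext c
  fin_cases c <;> simp

theorem subst_mem_nonZeroDivisors {a b : Fin n} (h : a ≠ b) {q : MvPolynomial (Fin 2) k}
    (hq : q ∈ nonZeroDivisors (MvPolynomial (Fin 2) k)) :
    subst a b q ∈ nonZeroDivisors (MvPolynomial (Fin n) k) := by
  rw [subst_eq_rename]
  refine rename_mem_nonZeroDivisors (fun c d hcd => ?_) hq
  fin_cases c <;> fin_cases d <;> simp_all [h.symm]

end Subst

section Sact

variable {I : Type w} {n : ℕ}

theorem sact_succ_apply {i j : Fin (n - 1)} (hij : j.val = i.val + 1) (v : Fin n → I) :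
    sact j v (lo i) = v (lo i) ∧ sact i v (hi j) = v (hi j) := by
  constructor <;> rw [sact, sperm_of_ne] <;> simp [lo, hi, Fin.ext_iff] <;> omega

theorem sact_sact_sact {i j : Fin (n - 1)} (hij : j.val = i.val + 1) {v : Fin n → I}
    (hv : v (lo i) = v (hi j)) :
    sact i (sact j (sact i v)) = v ∧ sact j (sact i (sact j v)) = v := by
  have hl := hi_eq_lo hij
  have h1 : sperm j (lo i) = lo i := sperm_of_ne j (hl ▸ lo_ne_hi i) (lo_ne_hi_succ hij)
  have h2 : sperm i (hi j) = hi j :=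
    sperm_of_ne i (lo_ne_hi_succ hij).symm (hl ▸ (lo_ne_hi j).symm)
  have h3 : sperm j (hi i) = hi j := by rw [hl, sperm_lo]
  have h4 : sperm i (lo j) = lo i := by rw [← hl, sperm_hi]
  constructor <;> funext a <;> simp only [sact] <;> by_cases ha : a = lo i
  · simp [ha, h3, h2, hv]
  · by_cases hb : a = hi i
    · simp [hb, h1]
    · by_cases hc : a = hi j
      · simp [hc, h2, h4, hv]
      · rw [sperm_of_ne i ha hb, sperm_of_ne j (hl ▸ hb) hc, sperm_of_ne i ha hb]
  · simp [ha, h3, h1, hv]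
  · by_cases hb : a = hi i
    · simp [hb, h2, hl]
    · by_cases hc : a = hi j
      · simp [hc, h4, h1, hv]
      · rw [sperm_of_ne j (hl ▸ hb) hc, sperm_of_ne i ha hb, sperm_of_ne j (hl ▸ hb) hc]

end Sact

section Torsion

variable {k : Type u} [CommRing k] {I : Type w} [Fintype I] [DecidableEq I] {n : ℕ}
  {Q : I → I → MvPolynomial (Fin 2) k}

/-- The arrows are recovered from the global elements by multiplying with idempotents, so closure
properties need only be checked on $1_v$, $x_a$ and $\tau_i$. -/
theorem HeckePre.subalgebra_eq_top (S : Subalgebra k (HeckePre n Q)) (he : ∀ v, ePre Q v ∈ S)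
    (hx : ∀ a, xPre Q a ∈ S) (hτ : ∀ i, τPre Q i ∈ S) : S = ⊤ := by
  refine eq_top_iff.2 fun a ha => ?_
  clear ha
  obtain ⟨a, rfl⟩ := Presented.mk_surjective (k := k) a
  obtain ⟨a, rfl⟩ := Presented.mk_surjective (k := k) a
  induction a using FreeAlgebra.induction with
  | grade0 r => simp only [AlgHom.commutes]; exact S.algebraMap_mem r
  | grade1 g =>
    rcases g with v | ⟨i, v⟩ | ⟨a, v⟩
    · exact he v
    · exact (τPre_mul_ePre (Q := Q) i v) ▸ S.mul_mem (hτ i) (he v)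
    · exact (xPre_mul_ePre (Q := Q) a v) ▸ S.mul_mem (hx a) (he v)
  | mul a b ha hb => rw [map_mul, map_mul]; exact S.mul_mem ha hb
  | add a b ha hb => rw [map_add, map_add]; exact S.add_mem ha hb

theorem τPre_mul_polyPre_of_ne (i : Fin (n - 1)) (f : MvPolynomial (Fin n) k) {v : Fin n → I}
    (hv : v (lo i) ≠ v (hi i)) :
    τPre Q i * polyPre Q f * ePre Q v
        = polyPre Q (rename (sperm i) f) * τPre Q i * ePre Q v := by
  obtain ⟨d, hd, h⟩ := τPre_mul_polyPre (Q := Q) i f v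
  rw [if_neg hv, mul_comm] at hd
  have h0 := mem_nonZeroDivisors_iff_right.1 (X_sub_X_mem_nonZeroDivisors (lo_ne_hi i).symm) d hd
  rw [h, h0, map_zero, zero_mul, add_zero]

/-- The centralizer contains all generators. For $\tau_i$, the correction term $d$ satisfies
$(x_{i+1}-x_i)d=f-s_i(f)=0$, and $x_{i+1}-x_i$ is regular. -/
theorem commute_polyPre_of_symmetric {f : MvPolynomial (Fin n) k}
    (hf : ∀ i : Fin (n - 1), rename (sperm i) f = f) (a : HeckePre n Q) :
    polyPre Q f * a = a * polyPre Q f := by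
  have hS := HeckePre.subalgebra_eq_top (Q := Q) (Subalgebra.centralizer k {polyPre Q f})
    (fun v => ?_) (fun b => ?_) (fun i => ?_)
  · have : a ∈ Subalgebra.centralizer k {polyPre Q f} := hS ▸ Algebra.mem_top
    exact Subalgebra.mem_centralizer_iff k |>.1 this _ rfl
  · rw [Subalgebra.mem_centralizer_iff]
    rintro _ rfl
    exact (commute_ePre_polyPre v f).eq.symm
  · rw [Subalgebra.mem_centralizer_iff]
    rintro _ rfl
    rw [← polyPre_X, ← map_mul, ← map_mul, mul_comm]
  · rw [Subalgebra.mem_centralizer_iff]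
    rintro _ rfl
    refine ext_mul_ePre fun v => ?_
    obtain ⟨d, hd, h⟩ := τPre_mul_polyPre (Q := Q) i f v
    rw [hf, sub_self, ite_self, mul_comm] at hd
    have h0 := mem_nonZeroDivisors_iff_right.1
      (X_sub_X_mem_nonZeroDivisors (lo_ne_hi i).symm) d hd
    rw [h, h0, hf, map_zero, zero_mul, add_zero]

/-- Every nonzerodivisor divides a symmetric one. -/
theorem exists_symmetric_multiple {f : MvPolynomial (Fin n) k}
    (hf : f ∈ nonZeroDivisors (MvPolynomial (Fin n) k)) :
    ∃ g ∈ nonZeroDivisors (MvPolynomial (Fin n) k), f ∣ g ∧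
      ∀ σ : Equiv.Perm (Fin n), rename σ g = g := by
  -- The witness is the product of all conjugates; `f` is its factor at the identity.
  refine ⟨∏ σ : Equiv.Perm (Fin n), rename σ f,
    prod_mem fun σ _ => rename_mem_nonZeroDivisors σ.injective hf, ?_, fun σ => ?_⟩
  · convert Finset.dvd_prod_of_mem (fun σ : Equiv.Perm (Fin n) => rename σ f)
      (Finset.mem_univ 1)
    simp
  · rw [map_prod]
    exact Fintype.prod_equiv (Equiv.mulLeft σ) _ _ fun ρ => by rw [rename_rename]; rfl

variable (n Q) in
/-- The polynomial torsion, as a two-sided ideal. -/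
def torsionIdeal : TwoSidedIdeal (HeckePre n Q) :=
  .mk' {a | IsPolyTorsion Q a} ⟨1, one_mem _, mul_zero _⟩
    (by
      rintro a b ⟨f, hf, ha⟩ ⟨g, hg, hb⟩
      refine ⟨f * g, mul_mem hf hg, ?_⟩
      rw [mul_add, map_mul, mul_assoc _ _ b, hb, mul_zero, add_zero, ← map_mul, mul_comm f, map_mul,
        mul_assoc, ha, mul_zero])
    (by
      rintro a ⟨f, hf, ha⟩
      exact ⟨f, hf, by rw [mul_neg, ha, neg_zero]⟩)
    (by
      rintro b a ⟨f, hf, ha⟩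
      -- Left multiples are the delicate side: `f` need not commute with `b`, but its symmetric
      -- multiple is central and still kills `a`.
      obtain ⟨g, hg, ⟨c, rfl⟩, hs⟩ := exists_symmetric_multiple hf
      refine ⟨f * c, hg, ?_⟩
      rw [← mul_assoc, commute_polyPre_of_symmetric fun i => hs _, mul_assoc, mul_comm f, map_mul,
        mul_assoc (polyPre Q c), ha, mul_zero, mul_zero])
    (by
      rintro a b ⟨f, hf, ha⟩
      exact ⟨f, hf, by rw [← mul_assoc, ha, zero_mul]⟩)

theorem mem_torsionIdeal (a : HeckePre n Q) : a ∈ torsionIdeal n Q ↔ IsPolyTorsion Q a :=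
  TwoSidedIdeal.mem_mk' ..

theorem mkPre_cubicDefect (i j : Fin (n - 1)) (v : Fin n → I) :
    mkPre n Q (cubicDefect Q i j v)
      = τPre Q j * τPre Q i * τPre Q j * ePre Q v - τPre Q i * τPre Q j * τPre Q i * ePre Q v
        - polyPre Q (divDiff (lo i) (hi i) (hi j) (Q (v (lo i)) (v (hi i)))) * ePre Q v := by
  rw [cubicDefect, map_sub, map_sub, τPre_mul_τPre_mul_τPre_mul_ePre,
    τPre_mul_τPre_mul_τPre_mul_ePre, mkPre_polyAt]

/-- Since $v_i=v_{i+2}$, the transposition of the outer positions fixes $v$, so all three terms of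
the defect end at $v$. -/
theorem ePre_mul_mkPre_cubicDefect {i j : Fin (n - 1)} (hij : j.val = i.val + 1)
    {v : Fin n → I} (hv : v (lo i) = v (hi j)) :
    ePre Q v * mkPre n Q (cubicDefect Q i j v) = mkPre n Q (cubicDefect Q i j v) := by
  have h3 : ∀ (a b : Fin (n - 1)), sact a (sact b (sact a v)) = v →
      ePre Q v * (τPre Q a * τPre Q b * τPre Q a * ePre Q v)
        = τPre Q a * τPre Q b * τPre Q a * ePre Q v := by
    intro a b hab
    have : τPre Q a * τPre Q b * τPre Q a * ePre Q v
        = ePre Q v * (τPre Q a * τPre Q b * τPre Q a) := by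
      rw [mul_assoc, τPre_ePre_comm, ← mul_assoc, mul_assoc (τPre Q a), τPre_ePre_comm,
        ← mul_assoc (τPre Q a), τPre_ePre_comm, hab]
      simp only [mul_assoc]
    rw [this, ← mul_assoc, ePre_mul_self]
  rw [mkPre_cubicDefect, mul_sub, mul_sub, h3 j i (sact_sact_sact hij hv).2,
    h3 i j (sact_sact_sact hij hv).1, ← mul_assoc, (commute_ePre_polyPre v _).eq,
    mul_assoc (polyPre Q _), ePre_mul_self]

/-- Write $v=(a,b,a)$ at the three positions. Up to a right factor $1_{s_i(v)}\tau_i$, the three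
terms of the product become $\tau_j g$, $s_j(g)\tau_j$ and $s_i(D)$, with $g=Q_{ba}(x_i,x_{i+2})$
and $D$ the divided difference. At $s_i(v)=(b,a,a)$ the last two colors agree, so moving $g$ through
$\tau_j$ produces exactly the correction $s_i(D)$. -/
theorem τPre_mul_mkPre_cubicDefect
    (hQ_symm : ∀ i j, Q i j = rename (Equiv.swap (0 : Fin 2) 1) (Q j i))
    {i j : Fin (n - 1)} (hij : j.val = i.val + 1)
    {v : Fin n → I} (hv : v (lo i) = v (hi j)) (hv' : v (hi i) ≠ v (lo i)) :
    τPre Q i * mkPre n Q (cubicDefect Q i j v) = 0 := by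
  have hl := hi_eq_lo hij
  have hsw : ∀ (a b : Fin n) (p q : I), subst a b (Q p q) = subst b a (Q q p) := by
    intro a b p q; rw [hQ_symm p q, subst_rename_swap]
  have h1 : sperm j (lo i) = lo i := sperm_of_ne j (hl ▸ lo_ne_hi i) (lo_ne_hi_succ hij)
  have h2 : sperm i (hi j) = hi j :=
    sperm_of_ne i (lo_ne_hi_succ hij).symm (hl ▸ (lo_ne_hi j).symm)
  set q := Q (v (lo i)) (v (hi i)) with hq
  set q' := Q (v (hi i)) (v (lo i)) with hq'
  set D := divDiff (lo i) (hi i) (hi j) q with hD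
  set g := subst (lo i) (hi j) q' with hg
  -- The braid relation at $s_j(v)=(a,a,b)$ brings the two factors $\tau_j$ together.
  have hA : τPre Q i * (τPre Q j * τPre Q i * τPre Q j * ePre Q v)
      = τPre Q j * polyPre Q g * ePre Q (sact i v) * τPre Q i := by
    have hbr := τPre_braid (Q := Q) hij (v := sact j v) (Or.inl (by
      rw [(sact_succ_apply hij v).1]; simpa [sact, ← hl] using hv'.symm))
    have hsq := τPre_sq (Q := Q) j v
    rw [← hl, ← hv, ← hq'] at hsq
    have hmv := τPre_mul_polyPre_of_ne (Q := Q) i (subst (hi i) (hi j) q') hv'.symm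
    rw [rename_subst, sperm_hi, h2, ← hg] at hmv
    calc _ = τPre Q i * τPre Q j * τPre Q i * ePre Q (sact j v) * τPre Q j := by
            rw [mul_assoc _ (τPre Q j), τPre_ePre_comm]; simp only [mul_assoc]
      _ = τPre Q j * (τPre Q i * (τPre Q j * τPre Q j * ePre Q v)) := by
            rw [← hbr, mul_assoc _ (ePre Q _), ← τPre_ePre_comm]; simp only [mul_assoc]
      _ = τPre Q j * (τPre Q i * polyPre Q (subst (hi i) (hi j) q') * ePre Q v) := by
            rw [hsq]; simp only [mul_assoc]
      _ = _ := by
            rw [hmv, mul_assoc _ (τPre Q i), τPre_ePre_comm]; simp only [mul_assoc]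
  have hB : τPre Q i * (τPre Q i * τPre Q j * τPre Q i * ePre Q v)
      = polyPre Q (rename (sperm j) g) * τPre Q j * ePre Q (sact i v) * τPre Q i := by
    have hsq := τPre_sq (Q := Q) i (sact j (sact i v))
    rw [show sact j (sact i v) (lo i) = v (hi i) by
        rw [(sact_succ_apply hij _).1]; simp [sact],
      show sact j (sact i v) (hi i) = v (lo i) by
        rw [hl, sact, sperm_lo, (sact_succ_apply hij _).2, hv], ← hq'] at hsq
    rw [hg, rename_subst, h1, sperm_hi, ← hl]
    calc _ = τPre Q i * τPre Q i * ePre Q (sact j (sact i v)) * τPre Q j * τPre Q i := by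
            rw [mul_assoc _ (τPre Q i) (ePre Q v), τPre_ePre_comm]
            simp only [mul_assoc]
            rw [← mul_assoc (τPre Q j) (ePre Q _), τPre_ePre_comm]
            simp only [mul_assoc]
      _ = _ := by
            rw [hsq, mul_assoc _ (ePre Q _), ← τPre_ePre_comm]; simp only [mul_assoc]
  have hC : τPre Q i * (polyPre Q D * ePre Q v)
      = polyPre Q (rename (sperm i) D) * ePre Q (sact i v) * τPre Q i := by
    rw [← mul_assoc, τPre_mul_polyPre_of_ne i D hv'.symm, mul_assoc _ (τPre Q i), τPre_ePre_comm]
    simp only [mul_assoc]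
  obtain ⟨d, hd, hmove⟩ := τPre_mul_polyPre (Q := Q) j g (sact i v)
  -- Both sides become equal after multiplication by the regular element $x_{i+2}-x_{i+1}$; the
  -- symmetry of $Q$ exchanges $Q_{ab}$ and $Q_{ba}$.
  have hdD : d = rename (sperm i) D := by
    have h0 : (sact i v) (lo j) = (sact i v) (hi j) := by
      rw [(sact_succ_apply hij v).2, ← hl, ← hv]; simp [sact]
    rw [if_pos h0, hg, rename_subst, h1, sperm_hi] at hd
    have hE := congrArg (rename (sperm i)) (sub_mul_divDiff (lo i) (hi i) (hi j) q)
    rw [map_mul, map_sub, map_sub, rename_X, rename_X, rename_subst, rename_subst, h2, sperm_lo,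
      sperm_hi, hq, hsw, hsw (hi i), ← hq', hl, ← hd] at hE
    have := mem_nonZeroDivisors_iff_right.1
      (X_sub_X_mem_nonZeroDivisors (lo_ne_hi j).symm) (rename (sperm i) D - d) (by
        rw [mul_comm, mul_sub, hD, hq, hl, hE, sub_self])
    exact (sub_eq_zero.1 this).symm
  rw [mkPre_cubicDefect, mul_sub, mul_sub, hA, hB, hC, hmove, hdD, add_mul, add_sub_cancel_left,
    sub_self]

/-- The cubic relation holds up to polynomial torsion. -/
theorem isPolyTorsion_cubicDefect
    (hQ_regular : ∀ i j, i ≠ j → Q i j ∈ nonZeroDivisors (MvPolynomial (Fin 2) k))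
    (hQ_symm : ∀ i j, Q i j = rename (Equiv.swap (0 : Fin 2) 1) (Q j i))
    {i j : Fin (n - 1)} (hij : j.val = i.val + 1)
    {v : Fin n → I} (hv : v (lo i) = v (hi j)) (hv' : v (hi i) ≠ v (lo i)) :
    IsPolyTorsion Q (mkPre n Q (cubicDefect Q i j v)) := by
  -- The annihilating polynomial is $Q_{v_i,v_{i+1}}(x_i,x_{i+1})$, which is $\tau_i^2$ on $1_v$.
  refine ⟨_, subst_mem_nonZeroDivisors (lo_ne_hi i) (hQ_regular _ _ hv'.symm), ?_⟩
  rw [← ePre_mul_mkPre_cubicDefect hij hv, ← mul_assoc, ← τPre_sq, mul_assoc _ (ePre Q v),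
    ePre_mul_mkPre_cubicDefect hij hv, mul_assoc, τPre_mul_mkPre_cubicDefect hQ_symm hij hv hv',
    mul_zero]

end Torsion

/-! ### Spanning families for algebras with relations of Hecke type -/

section Spanning

variable {H : Type u} [Ring H] (C : Subring H) (t : ℕ → H)

/-- Relations of Hecke type, modulo lower order terms with coefficients in `C`. -/
structure IsHeckeLike : Prop where
  move : ∀ i, ∀ f ∈ C, ∃ f' ∈ C, ∃ f'' ∈ C, t i * f = f' * t i + f''
  sq : ∀ i, t i * t i ∈ C
  comm : ∀ i j, i + 1 < j → t i * t j = t j * t i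
  braid : ∀ i, ∃ c ∈ C, t (i + 1) * t i * t (i + 1) = t i * t (i + 1) * t i + c

/-- The subring generated by `C` and `t 0, …, t (m - 1)`. -/
def level (m : ℕ) : Subring H := Subring.closure (C ∪ t '' {i | i < m})

/-- The product `t (j + d - 1) ⋯ t (j + 1) t j`. -/
def run : ℕ → ℕ → H
  | _, 0 => 1
  | j, d + 1 => run (j + 1) d * t j

/-- The left span over `level m` of the products `t m ⋯ t j'` with `j ≤ j' ≤ m + 1`. -/
def runSpan (m j : ℕ) : Submodule (level C t m) H :=
  Submodule.span _ {y | ∃ j' d, j' + d = m + 1 ∧ j ≤ j' ∧ y = run t j' d}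

variable {C t}

theorem le_level (m : ℕ) : C ≤ level C t m := fun _ h => Subring.subset_closure (Or.inl h)

theorem mem_level {m i : ℕ} (h : i < m) : t i ∈ level C t m :=
  Subring.subset_closure (Or.inr ⟨i, h, rfl⟩)

theorem run_mem {m j j' d : ℕ} (h : j' + d = m + 1) (hj : j ≤ j') : run t j' d ∈ runSpan C t m j :=
  Submodule.subset_span ⟨j', d, h, hj, rfl⟩

theorem mul_mem_runSpan {m j : ℕ} {a y : H} (ha : a ∈ level C t m) (hy : y ∈ runSpan C t m j) :
    a * y ∈ runSpan C t m j :=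
  (runSpan C t m j).smul_mem ⟨a, ha⟩ hy

theorem runSpan_anti {m j j' : ℕ} (h : j ≤ j') : runSpan C t m j' ≤ runSpan C t m j :=
  Submodule.span_mono fun _ ⟨i, d, h1, h2, h3⟩ => ⟨i, d, h1, h.trans h2, h3⟩

theorem runSpan_mul {m j j' : ℕ} {z : H}
    (h : ∀ i d, i + d = m + 1 → j ≤ i → run t i d * z ∈ runSpan C t m j')
    {y : H} (hy : y ∈ runSpan C t m j) : y * z ∈ runSpan C t m j' := by
  induction hy using Submodule.span_induction with
  | mem y hy => obtain ⟨i, d, h1, h2, rfl⟩ := hy; exact h i d h1 h2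
  | zero => rw [zero_mul]; exact zero_mem _
  | add a b _ _ ha hb => rw [add_mul]; exact add_mem ha hb
  | smul a b _ hb => rw [smul_mul_assoc]; exact Submodule.smul_mem _ _ hb

namespace IsHeckeLike

variable (h : IsHeckeLike C t)
include h

theorem run_comm {i j d : ℕ} (hij : i + 1 < j) : run t j d * t i = t i * run t j d := by
  induction d generalizing j with
  | zero => simp [run]
  | succ d ih =>
    rw [run, mul_assoc, ← h.comm i j hij, ← mul_assoc, ih (by omega), mul_assoc]

theorem runSpan_mul_of_lt {m j l : ℕ} (hl : l + 1 < j) {y : H} (hy : y ∈ runSpan C t m j) :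
    y * t l ∈ runSpan C t m j :=
  runSpan_mul (fun i d hd hj => by
    rw [h.run_comm (by omega)]
    exact mul_mem_runSpan (mem_level (by omega)) (run_mem hd hj)) hy

/-- A run ending at `j + 1` is lengthened by `t j`; a run ending further up commutes with it. -/
theorem runSpan_mul_pred {m j : ℕ} {y : H} (hy : y ∈ runSpan C t m (j + 1)) :
    y * t j ∈ runSpan C t m j :=
  runSpan_mul (fun i d hd hj => by
    obtain rfl | hlt := hj.eq_or_lt
    · exact run_mem (d := d + 1) (by omega) le_rfl
    · exact runSpan_anti (by omega : j ≤ i)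
        (h.runSpan_mul_of_lt (by omega) (run_mem hd le_rfl))) hy

theorem run_mul_mem {m j d : ℕ} (hd : j + d = m + 1) {f : H} (hf : f ∈ C) :
    run t j d * f ∈ runSpan C t m j := by
  induction d generalizing j f with
  | zero =>
    have := mul_mem_runSpan (le_level m hf) (run_mem (C := C) (t := t) hd le_rfl)
    simpa [run] using this
  | succ d ih =>
    obtain ⟨f', hf', f'', hf'', hff⟩ := h.move j f hf
    rw [run, mul_assoc, hff, mul_add, ← mul_assoc]
    exact add_mem (h.runSpan_mul_pred (ih (by omega) hf'))
      (runSpan_anti (Nat.le_succ j) (ih (by omega) hf''))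

/-- Move `t (i + 1)` left until it meets `t (i + 1) * t i`, apply the braid relation, and let the
resulting `t i` leave on the left. The braid error cuts the run at `i + 2`; the tail below `i`
commutes with what remains. -/
theorem run_mul_of_lt {m j d i : ℕ} (hd : j + d = m + 1) (hj : j ≤ i) (hi : i < m) :
    ∃ z ∈ runSpan C t m (i + 2), run t j d * t (i + 1) = t i * run t j d + z := by
  obtain ⟨r, rfl⟩ := Nat.exists_eq_add_of_le hj
  induction r generalizing j d with
  | zero =>
    obtain ⟨d, rfl⟩ : ∃ d', d = d' + 2 := ⟨d - 2, by omega⟩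
    obtain ⟨c, hc, hb⟩ := h.braid j
    refine ⟨run t (j + 2) d * c, h.run_mul_mem (by omega) hc, ?_⟩
    simp only [run, Nat.add_zero]
    rw [← mul_assoc (t j), ← mul_assoc (t j), ← h.run_comm (by omega : j + 1 < j + 1 + 1),
      mul_assoc _ (t (j + 1)), mul_assoc, hb, mul_add]
    simp only [mul_assoc]
  | succ r ih =>
    obtain ⟨d, rfl⟩ : ∃ d', d = d' + 1 := ⟨d - 1, by omega⟩
    have e1 : j + (r + 1) = j + 1 + r := by omega
    obtain ⟨z, hz, hr⟩ := ih (j := j + 1) (d := d) (by omega) (by omega) (by omega)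
    rw [e1]
    refine ⟨z * t j, h.runSpan_mul_of_lt (by omega) hz, ?_⟩
    rw [run, mul_assoc, h.comm j _ (by omega), ← mul_assoc, hr, add_mul, mul_assoc]

theorem runSpan_zero_mul {m i : ℕ} (hi : i ≤ m) {y : H} (hy : y ∈ runSpan C t m 0) :
    y * t i ∈ runSpan C t m 0 := by
  refine runSpan_mul (fun j d hd _ => ?_) hy
  rcases lt_trichotomy (i + 1) j with hij | hij | hij
  · exact runSpan_anti (Nat.zero_le j) (h.runSpan_mul_of_lt hij (run_mem hd le_rfl))
  · exact runSpan_anti (Nat.zero_le i) (h.runSpan_mul_pred (run_mem hd hij.le))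
  obtain rfl | hij := (Nat.lt_succ_iff.1 hij).eq_or_lt
  · obtain ⟨d, rfl⟩ : ∃ d', d = d' + 1 := ⟨d - 1, by omega⟩
    rw [run, mul_assoc]
    exact runSpan_anti (Nat.zero_le _) (h.run_mul_mem (by omega) (h.sq j))
  · obtain ⟨i, rfl⟩ : ∃ i', i = i' + 1 := ⟨i - 1, by omega⟩
    obtain ⟨z, hz, hr⟩ := h.run_mul_of_lt hd (Nat.lt_succ_iff.1 hij) hi
    rw [hr]
    exact add_mem (mul_mem_runSpan (mem_level hi) (run_mem hd (Nat.zero_le _)))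
      (runSpan_anti (Nat.zero_le _) hz)

/-- The span of all runs is stable under right multiplication by the generators and contains the
empty run 1. It mirrors the decomposition of a symmetric group into cosets of the preceding one. -/
theorem level_succ_le {m : ℕ} {y : H} (hy : y ∈ level C t (m + 1)) : y ∈ runSpan C t m 0 := by
  have key : ∀ z ∈ runSpan C t m 0, z * y ∈ runSpan C t m 0 := by
    induction hy using Subring.closure_induction with
    | mem y hy =>
      rcases hy with hy | ⟨i, hi, rfl⟩
      · exact fun z hz => runSpan_mul (fun j d hd _ =>
          runSpan_anti (Nat.zero_le _) (h.run_mul_mem hd hy)) hz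
      · exact fun z hz => h.runSpan_zero_mul (Nat.lt_succ_iff.1 hi) hz
    | zero => simp
    | one => simp
    | add a b _ _ ha hb => exact fun z hz => by rw [mul_add]; exact add_mem (ha z hz) (hb z hz)
    | neg a _ ha => exact fun z hz => by rw [mul_neg]; exact neg_mem (ha z hz)
    | mul a b _ _ ha hb => exact fun z hz => by rw [← mul_assoc]; exact hb _ (ha z hz)
  have h1 := key _ (run_mem (t := t) (j' := m + 1) (d := 0) rfl (Nat.zero_le _))
  simpa [run] using h1

open Nat in
/-- The subring generated by `C` and `t 0, …, t (m - 1)` is spanned over `C` by `(m + 1)!`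
elements. -/
theorem exists_spanning (m : ℕ) : ∃ (W : Type) (_ : Fintype W) (b : W → H),
    Fintype.card W = (m + 1)! ∧ ∀ y ∈ level C t m, y ∈ Submodule.span C (Set.range b) := by
  induction m with
  | zero =>
    refine ⟨Unit, inferInstance, fun _ => 1, rfl, fun y hy => ?_⟩
    have hy : y ∈ C := by simpa [level] using hy
    rw [Set.range_const, Submodule.mem_span_singleton]
    exact ⟨⟨y, hy⟩, mul_one y⟩
  | succ m ih =>
    obtain ⟨W, _, b, hW, hb⟩ := ih
    -- The index `m + 1` stands for the empty run, which gives `m + 2` runs in all.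
    refine ⟨Fin (m + 2) × W, inferInstance, fun p => b p.2 * run t p.1 (m + 1 - p.1), ?_,
      fun y hy => ?_⟩
    · rw [Fintype.card_prod, Fintype.card_fin, hW, ← Nat.factorial_succ]
    · replace hy := h.level_succ_le hy
      induction hy using Submodule.closure_induction with
      | zero => exact zero_mem _
      | add a b _ _ ha hb => exact add_mem ha hb
      | smul_mem a y hy =>
        obtain ⟨j, d, hd, -, rfl⟩ := hy
        obtain ⟨a, ha⟩ := a
        rw [Subring.smul_def, smul_eq_mul]
        dsimp only
        have ha' := hb a ha
        clear ha
        induction ha' using Submodule.span_induction with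
        | mem y hy =>
          obtain ⟨p, rfl⟩ := hy
          refine Submodule.subset_span ⟨(⟨j, by omega⟩, p), ?_⟩
          simp [show m + 1 - j = d by omega]
        | zero => rw [zero_mul]; exact zero_mem _
        | add a b _ _ ha hb => rw [add_mul]; exact add_mem ha hb
        | smul a b _ hb => rw [smul_mul_assoc]; exact Submodule.smul_mem _ _ hb

end IsHeckeLike

end Spanning

/-! ### Weight representations of the quiver Hecke algebra -/

section WeightRep

variable {k : Type u} [CommRing k] {I : Type w} {n : ℕ}

/-- The coefficients of an action of the quiver Hecke algebra on the functions on `𝔖_n` for which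
the `x_a` act diagonally: `y` lists the weights, and `c` the colors. -/
structure WeightData (Q : I → I → MvPolynomial (Fin 2) k) (K : Type*) [CommRing K] [Algebra k K]
    (c : Fin n → I) where
  y : Fin n → K
  α : Fin n → Fin n → K
  β : Fin n → Fin n → K
  β_mul_sub : ∀ p q, p ≠ q → c p = c q → β p q * (y q - y p) = 1
  β_swap : ∀ p q, β q p = -β p q
  β_of_ne : ∀ p q, c p ≠ c q → β p q = 0
  arnold : ∀ p q r, p ≠ q → q ≠ r → p ≠ r → β p r * (β p q + β q r) = β p q * β q r
  α_mul_α : ∀ p q, p ≠ q → α p q * α q p + β p q ^ 2 = aeval ![y p, y q] (Q (c p) (c q))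

theorem mul_sperm_mul_sperm (h : Equiv.Perm (Fin n)) (i : Fin (n - 1)) :
    h * sperm i * sperm i = h := by rw [mul_assoc, sperm_mul_self, mul_one]

theorem sperm_braid {i j : Fin (n - 1)} (hij : j.val = i.val + 1) :
    sperm j * sperm i * sperm j = sperm i * sperm j * sperm i := by
  have hl := hi_eq_lo hij
  have h1 := lo_ne_hi i
  have h2 := lo_ne_hi j
  have h3 := lo_ne_hi_succ hij
  rw [sperm, sperm, ← hl, Equiv.swap_mul_swap_mul_swap h1 h3,
    Equiv.swap_comm (lo i) (hi i), Equiv.swap_comm (hi i) (hi j),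
    Equiv.swap_mul_swap_mul_swap (hl ▸ h2.symm) h3.symm, Equiv.swap_comm]

theorem sperm_comm {i j : Fin (n - 1)} (hij : i.val + 1 < j.val ∨ j.val + 1 < i.val) :
    sperm i * sperm j = sperm j * sperm i := by
  have key : ∀ {i j : Fin (n - 1)}, i.val + 1 < j.val → Commute (sperm i) (sperm j) := by
    intro i j h
    refine Equiv.Perm.Disjoint.commute fun a => ?_
    by_cases h1 : a = lo i ∨ a = hi i
    · right
      apply sperm_of_ne <;> rcases h1 with rfl | rfl <;> simp [lo, hi, Fin.ext_iff] <;> omega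
    · left
      rw [not_or] at h1
      exact sperm_of_ne i h1.1 h1.2
  exact hij.elim (fun h => (key h).eq) fun h => (key h).eq.symm

theorem sperm_apply_of_far {i j : Fin (n - 1)} (hij : i.val + 1 < j.val ∨ j.val + 1 < i.val) :
    sperm i (lo j) = lo j ∧ sperm i (hi j) = hi j := by
  constructor <;> apply sperm_of_ne <;> simp [lo, hi, Fin.ext_iff] <;> omega

namespace WeightData

variable {Q : I → I → MvPolynomial (Fin 2) k} {K : Type*} [CommRing K] [Algebra k K]
  {c : Fin n → I} (D : WeightData Q K c)

/-- The endomorphisms of the space of functions on `𝔖_n`. -/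
abbrev Op (n : ℕ) (K : Type*) [CommRing K] := Module.End K (Equiv.Perm (Fin n) → K)

/-- Diagonal operators. -/
abbrev diag : (Equiv.Perm (Fin n) → K) →ₐ[K] Op n K := Algebra.lmul K _

/-- The action of polynomials in the `x_a`. -/
def polyOp : MvPolynomial (Fin n) k →ₐ[k] Op n K :=
  ((diag (n := n) (K := K)).restrictScalars k).comp
    (AlgHom.pi fun h => aeval fun a => D.y (h a))

/-- The action of `τ_i`. -/
def τOp (i : Fin (n - 1)) : Op n K where
  toFun F h := D.α (h (lo i)) (h (hi i)) * F (h * sperm i) + D.β (h (lo i)) (h (hi i)) * F h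
  map_add' F F' := by funext h; simp only [Pi.add_apply]; ring
  map_smul' r F := by funext h; simp only [Pi.smul_apply, smul_eq_mul, RingHom.id_apply]; ring

theorem polyOp_apply (f : MvPolynomial (Fin n) k) (F : Equiv.Perm (Fin n) → K)
    (h : Equiv.Perm (Fin n)) : D.polyOp f F h = aeval (fun a => D.y (h a)) f * F h := rfl

theorem τOp_apply (i : Fin (n - 1)) (F : Equiv.Perm (Fin n) → K) (h : Equiv.Perm (Fin n)) :
    D.τOp i F h
      = D.α (h (lo i)) (h (hi i)) * F (h * sperm i) + D.β (h (lo i)) (h (hi i)) * F h := rfl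

theorem τOp_sq (i : Fin (n - 1)) : D.τOp i * D.τOp i = diag fun h =>
    aeval ![D.y (h (lo i)), D.y (h (hi i))] (Q (c (h (lo i))) (c (h (hi i)))) := by
  refine LinearMap.ext fun F => funext fun h => ?_
  have hne : h (lo i) ≠ h (hi i) := h.injective.ne (lo_ne_hi i)
  simp only [Module.End.mul_apply, τOp_apply, Equiv.Perm.mul_apply, sperm_lo, sperm_hi,
    mul_sperm_mul_sperm, Algebra.coe_lmul_eq_mul, LinearMap.mul_apply', Pi.mul_apply]
  linear_combination F h * D.α_mul_α _ _ hne
    + D.α (h (lo i)) (h (hi i)) * F (h * sperm i) * D.β_swap (h (lo i)) (h (hi i))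

theorem τOp_comm {i j : Fin (n - 1)} (hij : i.val + 1 < j.val ∨ j.val + 1 < i.val) :
    D.τOp i * D.τOp j = D.τOp j * D.τOp i := by
  refine LinearMap.ext fun F => funext fun h => ?_
  have h1 := sperm_apply_of_far hij
  have h2 := sperm_apply_of_far hij.symm
  simp only [Module.End.mul_apply, τOp_apply, Equiv.Perm.mul_apply, h1.1, h1.2, h2.1, h2.2]
  rw [mul_assoc h, sperm_comm hij, ← mul_assoc]
  ring

/-- One diagonal formula covers every case: it vanishes when the outer colors differ (then
$\beta=0$) or all three agree (then $Q_{ii}=0$), and otherwise it is the divided difference. -/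
theorem τOp_braid {i j : Fin (n - 1)} (hij : j.val = i.val + 1) :
    D.τOp j * D.τOp i * D.τOp j - D.τOp i * D.τOp j * D.τOp i = diag fun h =>
      D.β (h (lo i)) (h (hi j)) *
        (aeval ![D.y (h (hi i)), D.y (h (hi j))] (Q (c (h (hi i))) (c (h (hi j))))
          - aeval ![D.y (h (lo i)), D.y (h (hi i))] (Q (c (h (lo i))) (c (h (hi i))))) := by
  refine LinearMap.ext fun F => funext fun h => ?_
  have hl := hi_eq_lo hij
  have h1 : sperm j (lo i) = lo i := sperm_of_ne j (hl ▸ lo_ne_hi i) (lo_ne_hi_succ hij)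
  have h2 : sperm i (hi j) = hi j :=
    sperm_of_ne i (lo_ne_hi_succ hij).symm (hl ▸ (lo_ne_hi j).symm)
  have h3 : sperm i (lo j) = lo i := by rw [← hl, sperm_hi]
  have h4 : h * sperm j * sperm i * sperm j = h * sperm i * sperm j * sperm i := by
    simp only [mul_assoc]; rw [← mul_assoc (sperm j), sperm_braid hij, mul_assoc]
  have hpq : h (lo i) ≠ h (lo j) := h.injective.ne (hl ▸ lo_ne_hi i)
  have hqr : h (lo j) ≠ h (hi j) := h.injective.ne (lo_ne_hi j)
  have hpr : h (lo i) ≠ h (hi j) := h.injective.ne (lo_ne_hi_succ hij)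
  simp only [Module.End.mul_apply, LinearMap.sub_apply, Pi.sub_apply, τOp_apply,
    Equiv.Perm.mul_apply, sperm_lo, sperm_hi, h1, h2, h3, hl, h4,
    mul_sperm_mul_sperm, Algebra.coe_lmul_eq_mul, LinearMap.mul_apply', Pi.mul_apply]
  rw [D.β_swap (h (lo j)) (h (hi j)), D.β_swap (h (lo i)) (h (lo j))]
  -- Values of $F$ at longer translates cancel identically. The coefficients at $hs_i$ and $hs_j$
  -- vanish by the Arnold relation; the one at $h$ also uses the quadratic relation.
  linear_combination (-F (h * sperm j) * D.α (h (lo j)) (h (hi j))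
      + F (h * sperm i) * D.α (h (lo i)) (h (lo j))
      + F h * (D.β (h (lo i)) (h (lo j)) - D.β (h (lo j)) (h (hi j)))) * D.arnold _ _ _ hpq hqr hpr
    + F h * D.β (h (lo i)) (h (hi j)) * (D.α_mul_α _ _ hqr - D.α_mul_α _ _ hpq)

theorem τOp_polyOp_X (i : Fin (n - 1)) (a : Fin n) :
    D.τOp i * D.polyOp (X a) - D.polyOp (X (sperm i a)) * D.τOp i = diag fun h =>
      D.β (h (lo i)) (h (hi i)) * (D.y (h a) - D.y (h (sperm i a))) := by
  refine LinearMap.ext fun F => funext fun h => ?_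
  simp only [Module.End.mul_apply, LinearMap.sub_apply, Pi.sub_apply, τOp_apply, polyOp_apply,
    Equiv.Perm.mul_apply, aeval_X, Algebra.coe_lmul_eq_mul, LinearMap.mul_apply', Pi.mul_apply]
  ring

theorem aeval_subst (h : Equiv.Perm (Fin n)) (a b : Fin n) (q : MvPolynomial (Fin 2) k) :
    aeval (fun a => D.y (h a)) (subst a b q) = aeval ![D.y (h a), D.y (h b)] q := by
  rw [subst_eq_rename, aeval_rename]
  congr 2
  funext c
  fin_cases c <;> rfl

variable [DecidableEq I]

/-- The action of `1_v`. -/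
def eOp (_D : WeightData Q K c) (v : Fin n → I) : Op n K :=
  diag fun h => if c ∘ h = v then 1 else 0

theorem diag_mul_eOp (f : Equiv.Perm (Fin n) → K) (v : Fin n → I) :
    diag f * D.eOp v = diag fun h => if c ∘ h = v then f h else 0 := by
  rw [eOp, ← map_mul]
  congr 1
  funext h
  simp

/-- Lets a relation at the vertex $v$ be checked only at permutations whose color vector is $v$. -/
theorem diag_mul_eOp_congr {f g : Equiv.Perm (Fin n) → K} {v : Fin n → I}
    (H : ∀ h : Equiv.Perm (Fin n), c ∘ h = v → f h = g h) :
    diag f * D.eOp v = diag g * D.eOp v := by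
  rw [diag_mul_eOp, diag_mul_eOp]
  congr 1
  funext h
  split_ifs with hc
  · exact H h hc
  · rfl

theorem eOp_mul_eOp (v w : Fin n → I) : D.eOp v * D.eOp w = if v = w then D.eOp v else 0 := by
  rw [eOp, diag_mul_eOp]
  split_ifs with hvw
  · subst hvw
    congr 1
    funext h
    split_ifs <;> rfl
  · rw [← map_zero diag]
    congr 1
    funext h
    split_ifs with h1 h2
    · exact absurd (h2.symm.trans h1) hvw
    · rfl
    · rfl

theorem sum_eOp [Fintype I] : ∑ v, D.eOp v = 1 := by
  simp only [eOp]
  rw [← map_sum, ← map_one diag]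
  congr 1
  funext h
  simp

/-- If the two colors agree, $s_i$ does not change the color vector; if they differ, $\beta=0$ and
only the translated term survives. -/
theorem τOp_mul_eOp (i : Fin (n - 1)) (v : Fin n → I) :
    D.τOp i * D.eOp v = D.eOp (sact i v) * D.τOp i := by
  refine LinearMap.ext fun F => funext fun h => ?_
  simp only [Module.End.mul_apply, τOp_apply, eOp, Algebra.coe_lmul_eq_mul, LinearMap.mul_apply',
    Pi.mul_apply]
  have h1 : c ∘ (h * sperm i : Equiv.Perm (Fin n)) = sact i (c ∘ h) := rfl
  simp only [h1, sact_eq_iff]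
  by_cases hc : c (h (lo i)) = c (h (hi i))
  · have h2 : sact i (c ∘ h) = c ∘ h := sact_eq_self hc
    simp only [← sact_eq_iff (v := c ∘ h), h2]
    split_ifs <;> ring
  · rw [D.β_of_ne _ _ hc]
    split_ifs <;> ring

theorem commute_eOp_polyOp (v : Fin n → I) (f : MvPolynomial (Fin n) k) :
    Commute (D.eOp v) (D.polyOp f) := by
  rw [Commute, SemiconjBy]
  exact (map_mul diag _ _).symm.trans ((congrArg diag (mul_comm _ _)).trans (map_mul diag _ _))

variable [Fintype I]

/-- The action of the arrows of the quiver. -/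
def arrowOp : PsiArrow I n → Op n K
  | .tau i v => D.τOp i * D.eOp v
  | .x a v => D.polyOp (X a) * D.eOp v

/-- The action of the quiver algebra. -/
def quiverRep : FreePsi k I n →ₐ[k] Op n K :=
  PathAlgebra.lift D.eOp D.arrowOp D.eOp_mul_eOp D.sum_eOp
    (by
      rintro (⟨i, v⟩ | ⟨a, v⟩)
      · change D.eOp (sact i v) * (D.τOp i * D.eOp v) = D.τOp i * D.eOp v
        rw [← mul_assoc, ← τOp_mul_eOp, mul_assoc, eOp_mul_eOp, if_pos rfl]
      · change D.eOp v * (D.polyOp (X a) * D.eOp v) = D.polyOp (X a) * D.eOp v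
        rw [← mul_assoc, (D.commute_eOp_polyOp _ _).eq, mul_assoc, eOp_mul_eOp, if_pos rfl])
    (by
      rintro (⟨i, v⟩ | ⟨a, v⟩)
      · change D.τOp i * D.eOp v * D.eOp v = D.τOp i * D.eOp v
        rw [mul_assoc, eOp_mul_eOp, if_pos rfl]
      · change D.polyOp (X a) * D.eOp v * D.eOp v = D.polyOp (X a) * D.eOp v
        rw [mul_assoc, eOp_mul_eOp, if_pos rfl])

theorem quiverRep_e (v : Fin n → I) : D.quiverRep (e k v) = D.eOp v :=
  PathAlgebra.lift_vertex ..

theorem quiverRep_τ (i : Fin (n - 1)) (v : Fin n → I) :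
    D.quiverRep (τ k i v) = D.τOp i * D.eOp v :=
  PathAlgebra.lift_arrow ..

theorem quiverRep_x (a : Fin n) (v : Fin n → I) :
    D.quiverRep (x k a v) = D.polyOp (X a) * D.eOp v :=
  PathAlgebra.lift_arrow ..

theorem quiverRep_polyAt (v : Fin n → I) (F : MvPolynomial (Fin n) k) :
    D.quiverRep (polyAt v F) = D.polyOp F * D.eOp v := by
  rw [map_polyAt D.quiverRep D.polyOp v (fun a => ?_) (fun a => ?_), quiverRep_e]
  · rw [quiverRep_x, quiverRep_e]
  · rw [quiverRep_e]; exact D.commute_eOp_polyOp v _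

theorem quiverRep_τ_mul_τ (i j : Fin (n - 1)) (v : Fin n → I) :
    D.quiverRep (τ k i (sact j v) * τ k j v) = D.τOp i * D.τOp j * D.eOp v := by
  rw [map_mul, quiverRep_τ, quiverRep_τ, mul_assoc, ← mul_assoc (D.eOp _), ← τOp_mul_eOp,
    mul_assoc (D.τOp j), eOp_mul_eOp, if_pos rfl, mul_assoc]

theorem quiverRep_τ_mul_τ_mul_τ (i j l : Fin (n - 1)) (v : Fin n → I) :
    D.quiverRep (τ k i (sact j (sact l v)) * τ k j (sact l v) * τ k l v)
      = D.τOp i * D.τOp j * D.τOp l * D.eOp v := by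
  rw [map_mul, quiverRep_τ_mul_τ, quiverRep_τ, mul_assoc, ← mul_assoc (D.eOp _), ← τOp_mul_eOp,
    mul_assoc (D.τOp l), eOp_mul_eOp, if_pos rfl, mul_assoc (_ * _)]

theorem quiverRep_basicRel (hQ_diag : ∀ i, Q i i = 0) {a b : FreePsi k I n} (hab : BasicRel Q a b) :
    D.quiverRep a = D.quiverRep b := by
  rcases hab with ⟨i, v⟩ | ⟨i, j, v, hij⟩ | ⟨i, j, hij, v, hv⟩ | ⟨a, b, v⟩ | ⟨i, a, v⟩
  · rw [quiverRep_τ_mul_τ, quiverRep_polyAt, τOp_sq]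
    refine D.diag_mul_eOp_congr fun h hc => ?_
    subst hc
    exact (D.aeval_subst h _ _ _).symm
  · rw [quiverRep_τ_mul_τ, quiverRep_τ_mul_τ, D.τOp_comm hij]
  · rw [quiverRep_τ_mul_τ_mul_τ, quiverRep_τ_mul_τ_mul_τ, ← sub_eq_zero, ← sub_mul,
      D.τOp_braid hij, ← zero_mul (D.eOp v), ← map_zero diag]
    refine D.diag_mul_eOp_congr fun h hc => ?_
    subst hc
    rcases hv with hv | hv
    · rw [D.β_of_ne _ _ hv, zero_mul]; rfl
    · simp only [Function.comp_apply] at hv ⊢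
      rw [← hv.2, ← hv.1, hQ_diag]
      simp
  · have key : ∀ a b, D.quiverRep (x k a v * x k b v)
        = D.polyOp (X a * X b) * (D.eOp v * D.eOp v) := by
      intro a b
      rw [map_mul, quiverRep_x, quiverRep_x, mul_assoc, ← mul_assoc (D.eOp v),
        (D.commute_eOp_polyOp _ _).eq, map_mul]
      simp only [mul_assoc]
    rw [key, key, mul_comm (X a)]
  · have hE : D.quiverRep (τ k i v * x k a v - x k (sperm i a) (sact i v) * τ k i v)
        = (D.τOp i * D.polyOp (X a) - D.polyOp (X (sperm i a)) * D.τOp i) * D.eOp v := by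
      rw [map_sub, map_mul, map_mul, quiverRep_x, quiverRep_x, quiverRep_τ, sub_mul]
      congr 1
      · rw [mul_assoc, ← mul_assoc (D.eOp v), (D.commute_eOp_polyOp _ _).eq, mul_assoc _ (D.eOp v),
          eOp_mul_eOp, if_pos rfl, mul_assoc]
      · rw [mul_assoc, ← mul_assoc (D.eOp _), ← τOp_mul_eOp, mul_assoc _ (D.eOp v),
          eOp_mul_eOp, if_pos rfl, mul_assoc]
    have hR : D.quiverRep (if a = lo i ∧ v (lo i) = v (hi i) then -e k v
          else if a = hi i ∧ v (lo i) = v (hi i) then e k v else 0)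
        = diag (fun _ => if a = lo i ∧ v (lo i) = v (hi i) then -1
          else if a = hi i ∧ v (lo i) = v (hi i) then 1 else 0) * D.eOp v := by
      split_ifs
      · rw [map_neg, quiverRep_e]
        have h : diag (-1) * D.eOp v = -D.eOp v := by
          rw [map_neg, map_one]
          exact neg_one_mul (D.eOp v)
        exact h.symm
      · rw [quiverRep_e]
        exact ((congrArg (· * _) (map_one diag)).trans (one_mul _)).symm
      · rw [map_zero]
        exact ((congrArg (· * _) (map_zero diag)).trans (zero_mul _)).symm
    rw [hE, hR, τOp_polyOp_X]
    refine D.diag_mul_eOp_congr fun h hc => ?_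
    subst hc
    simp only [Function.comp_apply]
    by_cases hc : c (h (lo i)) = c (h (hi i))
    · have hb := D.β_mul_sub _ _ (h.injective.ne (lo_ne_hi i)) hc
      by_cases h1 : a = lo i
      · subst h1
        rw [sperm_lo, if_pos ⟨rfl, hc⟩]
        linear_combination -hb
      by_cases h2 : a = hi i
      · subst h2
        rw [sperm_hi, if_neg (fun h => h1 h.1), if_pos ⟨rfl, hc⟩, hb]
      rw [sperm_of_ne i h1 h2]
      simp [h1, h2]
    · simp [hc, D.β_of_ne _ _ hc]

theorem quiverRep_fullRel (hQ_diag : ∀ i, Q i i = 0)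
    (hQ_symm : ∀ i j, Q i j = rename (Equiv.swap (0 : Fin 2) 1) (Q j i))
    {a b : FreePsi k I n} (hab : FullRel Q a b) :
    D.quiverRep a = D.quiverRep b := by
  rcases hab with hab | ⟨i, j, hij, v, hv, hv'⟩
  · exact D.quiverRep_basicRel hQ_diag hab
  rw [cubicDefect, map_sub, map_sub, quiverRep_τ_mul_τ_mul_τ, quiverRep_τ_mul_τ_mul_τ,
    quiverRep_polyAt, map_zero, ← sub_mul, D.τOp_braid hij, sub_eq_zero]
  refine D.diag_mul_eOp_congr fun h hc => ?_
  subst hc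
  simp only [Function.comp_apply] at hv hv' ⊢
  have hd := congrArg (aeval fun a => D.y (h a))
    (sub_mul_divDiff (lo i) (hi i) (hi j) (Q (c (h (lo i))) (c (h (hi i)))))
  have hb := D.β_mul_sub (h (lo i)) (h (hi j)) (h.injective.ne (lo_ne_hi_succ hij)) hv
  rw [map_mul, map_sub, map_sub, aeval_X, aeval_X, aeval_subst, aeval_subst] at hd
  -- Symmetry of $Q$ and equality of the outer colors turn the difference of two $Q$'s into the
  -- numerator of the divided difference; $\beta$ supplies the inverse denominator.
  have hs : aeval ![D.y (h (hi i)), D.y (h (hi j))] (Q (c (h (hi i))) (c (h (hi j))))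
      = aeval ![D.y (h (hi j)), D.y (h (hi i))] (Q (c (h (lo i))) (c (h (hi i)))) := by
    rw [← aeval_subst, ← aeval_subst, ← hv, hQ_symm (c (h (hi i))), subst_rename_swap]
  rw [hs, ← hd, ← mul_assoc, hb, one_mul]
  rfl

/-- The action of the quiver Hecke algebra. -/
def rep (hQ_diag : ∀ i, Q i i = 0)
    (hQ_symm : ∀ i j, Q i j = rename (Equiv.swap (0 : Fin 2) 1) (Q j i)) :
    Hecke n Q →ₐ[k] Op n K :=
  Presented.lift D.quiverRep fun _ _ h => D.quiverRep_fullRel hQ_diag hQ_symm h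

theorem rep_mkHecke (hQ_diag : ∀ i, Q i i = 0)
    (hQ_symm : ∀ i j, Q i j = rename (Equiv.swap (0 : Fin 2) 1) (Q j i))
    (a : FreePsi k I n) : D.rep hQ_diag hQ_symm (mkHecke n Q a) = D.quiverRep a :=
  Presented.lift_mk _ _ _

end WeightData

end WeightRep

/-! ### The generic weight representation -/

section Generic

variable {k : Type u} [CommRing k] {I : Type w} {n : ℕ}

theorem closure_sperm (n : ℕ) :
    Submonoid.closure (Set.range (sperm : Fin (n - 1) → Equiv.Perm (Fin n))) = ⊤ := by
  cases n with
  | zero => exact eq_top_iff.2 fun h _ => Subsingleton.elim 1 h ▸ one_mem _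
  | succ n => exact Equiv.Perm.mclosure_swap_castSucc_succ n

variable (k n) in
/-- The total fraction ring of the polynomial ring. -/
abbrev TotalFraction := FractionRing (MvPolynomial (Fin n) k)

variable (k) in
/-- The variable `x_a`, as an element of the total fraction ring. -/
def weight (a : Fin n) : TotalFraction k n := algebraMap (MvPolynomial (Fin n) k) _ (X a)

theorem isUnit_weight_sub_weight {p q : Fin n} (h : p ≠ q) :
    IsUnit (weight k q - weight k p) := by
  rw [weight, weight, ← map_sub]
  exact IsLocalization.map_units (TotalFraction k n) ⟨_, X_sub_X_mem_nonZeroDivisors h.symm⟩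

theorem aeval_generic (a b : Fin n) (q : MvPolynomial (Fin 2) k) :
    aeval ![weight k a, weight k b] q
      = algebraMap (MvPolynomial (Fin n) k) (TotalFraction k n) (subst a b q) := by
  rw [subst, ← aeval_algebraMap_apply]
  congr 2
  funext c
  fin_cases c <;> rfl

variable [DecidableEq I]

/-- The coefficient `1 / (x_q - x_p)` for equal colors. -/
def genericβ (k : Type u) [CommRing k] (c : Fin n → I) (p q : Fin n) : TotalFraction k n :=
  if c p = c q then Ring.inverse (weight k q - weight k p) else 0

theorem genericβ_mul_sub (c : Fin n → I) (p q : Fin n) (hpq : p ≠ q) (hc : c p = c q) :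
    genericβ k c p q * (weight k q - weight k p) = 1 := by
  rw [genericβ, if_pos hc]
  exact Ring.inverse_mul_cancel _ (isUnit_weight_sub_weight hpq)

theorem genericβ_of_ne (c : Fin n → I) (p q : Fin n) (hc : c p ≠ c q) : genericβ k c p q = 0 :=
  if_neg hc

theorem genericβ_arnold (c : Fin n → I) (p q r : Fin n) (hpq : p ≠ q) (hqr : q ≠ r) (hpr : p ≠ r) :
    genericβ k c p r * (genericβ k c p q + genericβ k c q r)
      = genericβ k c p q * genericβ k c q r := by
  by_cases h1 : c p = c q
  · by_cases h2 : c q = c r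
    · have e1 := genericβ_mul_sub (k := k) c p q hpq h1
      have e2 := genericβ_mul_sub (k := k) c q r hqr h2
      have e3 := genericβ_mul_sub (k := k) c p r hpr (h1.trans h2)
      linear_combination genericβ k c p q * genericβ k c q r * e3
        - genericβ k c p r * genericβ k c p q * e2 - genericβ k c p r * genericβ k c q r * e1
    · rw [genericβ_of_ne c q r h2, genericβ_of_ne c p r (h1 ▸ h2)]; ring
  · rw [genericβ_of_ne c p q h1]
    by_cases h2 : c q = c r
    · rw [genericβ_of_ne c p r (h2 ▸ h1)]; ring
    · rw [genericβ_of_ne c q r h2]; ring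

/-- The off-diagonal coefficients of `τ_i`. -/
def genericα (Q : I → I → MvPolynomial (Fin 2) k) (c : Fin n → I) (p q : Fin n) :
    TotalFraction k n :=
  if c p = c q then -genericβ k c p q
  else if p < q then algebraMap (MvPolynomial (Fin n) k) _ (subst p q (Q (c p) (c q))) else 1

theorem isUnit_genericα {Q : I → I → MvPolynomial (Fin 2) k}
    (hQ_regular : ∀ i j, i ≠ j → Q i j ∈ nonZeroDivisors (MvPolynomial (Fin 2) k))
    (c : Fin n → I) {p q : Fin n} (hpq : p ≠ q) : IsUnit (genericα Q c p q) := by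
  rw [genericα]
  split_ifs with h1 h2
  · exact (IsUnit.of_mul_eq_one _ (genericβ_mul_sub c p q hpq h1)).neg
  · exact IsLocalization.map_units (TotalFraction k n)
      ⟨_, subst_mem_nonZeroDivisors hpq (hQ_regular _ _ h1)⟩
  · exact isUnit_one

/-- The weights `x_1, …, x_n` in the total fraction ring of `k[x_1, …, x_n]`. -/
def genericData {Q : I → I → MvPolynomial (Fin 2) k} (hQ_diag : ∀ i, Q i i = 0)
    (hQ_symm : ∀ i j, Q i j = rename (Equiv.swap (0 : Fin 2) 1) (Q j i)) (c : Fin n → I) :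
    WeightData Q (TotalFraction k n) c where
  y := weight k
  α := genericα Q c
  β := genericβ k c
  β_mul_sub := genericβ_mul_sub c
  β_swap p q := by
    by_cases hpq : p = q
    · subst hpq
      simp [genericβ]
    by_cases hc : c p = c q
    · refine (isUnit_weight_sub_weight (k := k) hpq).mul_right_cancel ?_
      have h1 := genericβ_mul_sub (k := k) c p q hpq hc
      have h2 := genericβ_mul_sub (k := k) c q p (Ne.symm hpq) hc.symm
      linear_combination -h2 + h1
    · rw [genericβ_of_ne c p q hc, genericβ_of_ne c q p (Ne.symm hc), neg_zero]
  β_of_ne := genericβ_of_ne c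
  arnold := genericβ_arnold c
  α_mul_α p q hpq := by
    rw [aeval_generic]
    by_cases hc : c p = c q
    · rw [hc, hQ_diag, subst, map_zero, map_zero, genericα, genericα, if_pos hc, if_pos hc.symm]
      have h1 := genericβ_mul_sub (k := k) c p q hpq hc
      have h2 := genericβ_mul_sub (k := k) c q p (Ne.symm hpq) hc.symm
      linear_combination -genericβ k c p q * (genericβ k c p q * h2 + genericβ k c q p * h1)
    · rw [genericβ_of_ne c p q hc, genericα, genericα, if_neg hc, if_neg (Ne.symm hc)]
      rcases lt_or_gt_of_ne hpq with h | h
      · rw [if_pos h, if_neg h.not_gt]; ring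
      · rw [if_pos h, if_neg h.not_gt, hQ_symm (c p), subst_rename_swap]; ring

end Generic

/-! ### Coefficients -/

section Coefficients

variable {k : Type u} [CommRing k] {I : Type w} [Fintype I] [DecidableEq I] {n : ℕ}
  (Q : I → I → MvPolynomial (Fin 2) k)

/-- The morphism `(f_v)_v ↦ ∑_v f_v(x) 1_v`. -/
def coeffPre : ((Fin n → I) → MvPolynomial (Fin n) k) →+* HeckePre n Q where
  toFun f := ∑ v, polyPre Q (f v) * ePre Q v
  map_zero' := by simp
  map_one' := by simp [sum_ePre]
  map_add' f g := by simp [add_mul, Finset.sum_add_distrib]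
  map_mul' f g := by
    rw [Finset.sum_mul_sum]
    refine Finset.sum_congr rfl fun v _ => ?_
    rw [Finset.sum_eq_single v]
    · rw [Pi.mul_apply, map_mul, mul_assoc (polyPre Q (f v)) (ePre Q v), ← mul_assoc (ePre Q v),
        (commute_ePre_polyPre v _).eq, mul_assoc _ (ePre Q v), ePre_mul_self, ← mul_assoc]
    · intro u _ hu
      rw [mul_assoc, ← mul_assoc (ePre Q v), (commute_ePre_polyPre v _).eq, mul_assoc _ (ePre Q v),
        ePre_mul_ePre, if_neg hu.symm, mul_zero, mul_zero]
    · simp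

theorem coeffPre_apply (f : (Fin n → I) → MvPolynomial (Fin n) k) :
    coeffPre Q f = ∑ v, polyPre Q (f v) * ePre Q v := rfl

theorem coeffPre_mul_ePre (f : (Fin n → I) → MvPolynomial (Fin n) k) (v : Fin n → I) :
    coeffPre Q f * ePre Q v = polyPre Q (f v) * ePre Q v := by
  rw [coeffPre_apply, Finset.sum_mul, Finset.sum_eq_single v]
  · rw [mul_assoc, ePre_mul_self]
  · intro u _ hu
    rw [mul_assoc, ePre_mul_ePre, if_neg hu, mul_zero]
  · simp

theorem coeffPre_const (f : MvPolynomial (Fin n) k) : coeffPre Q (fun _ => f) = polyPre Q f := by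
  rw [coeffPre_apply, ← Finset.mul_sum, sum_ePre, mul_one]

theorem coeffPre_single (v : Fin n → I) : coeffPre Q (Pi.single v 1) = ePre Q v := by
  refine ext_mul_ePre fun u => ?_
  rw [coeffPre_mul_ePre, ePre_mul_ePre]
  by_cases h : v = u
  · subst h; simp
  · simp [h, Ne.symm h]

variable (n) in
/-- The same morphism with values in `H_n(Q)`. -/
def coeffHecke : ((Fin n → I) → MvPolynomial (Fin n) k) →+* Hecke n Q :=
  (canonicalMap n Q : HeckePre n Q →+* Hecke n Q).comp (coeffPre Q)

theorem coeffHecke_apply (f : (Fin n → I) → MvPolynomial (Fin n) k) :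
    coeffHecke n Q f = canonicalMap n Q (coeffPre Q f) := rfl

variable (n) in
/-- The generators `τ_i` of `H_n(Q)`, extended by zero. -/
def τHecke (i : ℕ) : Hecke n Q :=
  if h : i < n - 1 then canonicalMap n Q (τPre Q ⟨i, h⟩) else 0

variable {Q}

theorem canonicalMap_surjective : Function.Surjective (canonicalMap n Q) := by
  intro a
  obtain ⟨a, rfl⟩ := Presented.mk_surjective (k := k) a
  exact ⟨mkPre n Q a, canonicalMap_mkPre n Q a⟩

theorem exists_move (i : Fin (n - 1)) (f : (Fin n → I) → MvPolynomial (Fin n) k) :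
    ∃ f' f'', τPre Q i * coeffPre Q f = coeffPre Q f' * τPre Q i + coeffPre Q f'' := by
  choose d _ hd using fun v => τPre_mul_polyPre (Q := Q) i (f v) v
  -- The coefficient is read at $s_i(v)$ because $\tau_i$ carries $1_v$ to $1_{s_i(v)}$.
  refine ⟨fun v => rename (sperm i) (f (sact i v)), d, ext_mul_ePre fun v => ?_⟩
  rw [add_mul, mul_assoc, coeffPre_mul_ePre, ← mul_assoc, hd, coeffPre_mul_ePre, mul_assoc,
    mul_assoc, τPre_ePre_comm, ← mul_assoc (coeffPre Q _), coeffPre_mul_ePre, sact_sact, mul_assoc]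

theorem exists_braid {i j : Fin (n - 1)} (hij : j.val = i.val + 1) :
    ∃ f, canonicalMap n Q (τPre Q j * τPre Q i * τPre Q j)
      = canonicalMap n Q (τPre Q i * τPre Q j * τPre Q i) + coeffHecke n Q f := by
  -- The error is the divided difference at the vertices of the cubic relation, and zero where the
  -- plain braid relation holds.
  refine ⟨fun v => if v (lo i) = v (hi j) ∧ v (hi i) ≠ v (lo i) then
    divDiff (lo i) (hi i) (hi j) (Q (v (lo i)) (v (hi i))) else 0, ?_⟩
  rw [coeffHecke_apply, ← sub_eq_zero, ← map_add, ← map_sub, ← mul_one (_ - _), ← sum_ePre,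
    Finset.mul_sum, map_sum]
  refine Finset.sum_eq_zero fun v _ => ?_
  rw [sub_mul, add_mul, coeffPre_mul_ePre]
  split_ifs with hv
  · rw [← sub_sub, ← mkPre_cubicDefect, canonicalMap_mkPre]
    have := Presented.mk_rel (k := k) (FullRel.cubic (Q := Q) i j hij v hv.1 hv.2)
    rwa [map_zero] at this
  · rw [τPre_braid hij]
    · simp
    · rw [not_and_or, not_not] at hv
      by_cases h1 : v (lo i) = v (hi j)
      · have h2 := hv.resolve_left (not_not.2 h1)
        exact Or.inr ⟨h2.symm, h2.trans h1⟩
      · exact Or.inl h1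

theorem isHeckeLike : IsHeckeLike (coeffHecke n Q).range (τHecke n Q) where
  move i := by
    rintro _ ⟨f, rfl⟩
    by_cases hi : i < n - 1
    · obtain ⟨f', f'', h⟩ := exists_move (Q := Q) ⟨i, hi⟩ f
      refine ⟨_, ⟨f', rfl⟩, _, ⟨f'', rfl⟩, ?_⟩
      simp only [τHecke, dif_pos hi, coeffHecke_apply, ← map_mul, ← map_add, h]
    · exact ⟨0, zero_mem _, 0, zero_mem _, by simp [τHecke, hi]⟩
  sq i := by
    by_cases hi' : i < n - 1
    · refine ⟨fun v => subst (lo ⟨i, hi'⟩) (hi ⟨i, hi'⟩)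
        (Q (v (lo ⟨i, hi'⟩)) (v (hi ⟨i, hi'⟩))), ?_⟩
      simp only [τHecke, dif_pos hi', coeffHecke_apply, ← map_mul]
      refine congrArg _ (ext_mul_ePre fun v => ?_)
      rw [coeffPre_mul_ePre, τPre_sq]
    · simp [τHecke, hi', zero_mem]
  comm i j hij := by
    by_cases hj : j < n - 1
    · have hi : i < n - 1 := by omega
      simp only [τHecke, dif_pos hi, dif_pos hj, ← map_mul]
      rw [τPre_comm _ _ (Or.inl hij)]
    · simp [τHecke, hj]
  braid i := by
    by_cases hj : i + 1 < n - 1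
    · have hi : i < n - 1 := by omega
      obtain ⟨f, hf⟩ := exists_braid (Q := Q) (i := ⟨i, hi⟩) (j := ⟨i + 1, hj⟩) rfl
      refine ⟨_, ⟨f, rfl⟩, ?_⟩
      simp only [τHecke, dif_pos hi, dif_pos hj, ← map_mul, hf]
    · exact ⟨0, zero_mem _, by simp [τHecke, hj]⟩

theorem mem_level_hecke (a : Hecke n Q) : a ∈ level (coeffHecke n Q).range (τHecke n Q) (n - 1) := by
  obtain ⟨a, rfl⟩ := canonicalMap_surjective a
  let S : Subalgebra k (HeckePre n Q) :=
    { (level (coeffHecke n Q).range (τHecke n Q) (n - 1)).comap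
        (canonicalMap n Q : HeckePre n Q →+* Hecke n Q) with
      algebraMap_mem' := fun r => le_level _ ⟨fun _ => algebraMap k _ r, by
        rw [coeffHecke_apply, coeffPre_const, AlgHom.commutes]; rfl⟩ }
  have hS := HeckePre.subalgebra_eq_top S
    (fun v => le_level _ ⟨_, congrArg (canonicalMap n Q) (coeffPre_single Q v)⟩)
    (fun b => le_level _ ⟨fun _ => X b, by rw [coeffHecke_apply, coeffPre_const, polyPre_X]; rfl⟩)
    (fun i => by
      have := mem_level (C := (coeffHecke n Q).range) (t := τHecke n Q) i.2
      rw [τHecke, dif_pos i.2] at this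
      exact this)
  exact (hS ▸ Algebra.mem_top : a ∈ S)

end Coefficients

/-! ### The quiver Hecke algebra is torsion free -/

section Row

variable {k : Type u} [CommRing k] {I : Type w} [Fintype I] [DecidableEq I] {n : ℕ}
  {Q : I → I → MvPolynomial (Fin 2) k} {K : Type*} [CommRing K] [Algebra k K]
  {c : Fin n → I} (D : WeightData Q K c)
  (hQ_diag : ∀ i, Q i i = 0)
  (hQ_symm : ∀ i j, Q i j = rename (Equiv.swap (0 : Fin 2) 1) (Q j i))

namespace WeightData

theorem rep_ePre (v : Fin n → I) :
    D.rep hQ_diag hQ_symm (canonicalMap n Q (ePre Q v)) = D.eOp v := by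
  rw [ePre, canonicalMap_mkPre, rep_mkHecke, quiverRep_e]

theorem rep_τPre (i : Fin (n - 1)) :
    D.rep hQ_diag hQ_symm (canonicalMap n Q (τPre Q i)) = D.τOp i := by
  simp only [τPre, map_sum, canonicalMap_mkPre, rep_mkHecke, quiverRep_τ]
  rw [← Finset.mul_sum, sum_eOp, mul_one]

theorem rep_polyPre (f : MvPolynomial (Fin n) k) :
    D.rep hQ_diag hQ_symm (canonicalMap n Q (polyPre Q f)) = D.polyOp f := by
  suffices h : ((D.rep hQ_diag hQ_symm).comp (canonicalMap n Q)).comp (polyPre Q) = D.polyOp from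
    AlgHom.congr_fun h f
  refine algHom_ext fun a => ?_
  simp only [AlgHom.comp_apply, polyPre_X, xPre, map_sum, canonicalMap_mkPre, rep_mkHecke,
    quiverRep_x]
  rw [← Finset.mul_sum, sum_eOp, mul_one]

/-- The matrix coefficients `F ↦ (a F)(1)`. -/
def row (a : Hecke n Q) : Module.Dual K (Equiv.Perm (Fin n) → K) :=
  LinearMap.proj 1 ∘ₗ D.rep hQ_diag hQ_symm a

theorem row_mul (a b : Hecke n Q) :
    D.row hQ_diag hQ_symm (a * b) = D.row hQ_diag hQ_symm a ∘ₗ D.rep hQ_diag hQ_symm b := by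
  rw [row, map_mul]; rfl

theorem row_sum {W : Type*} [Fintype W] (a : W → Hecke n Q) :
    D.row hQ_diag hQ_symm (∑ i, a i) = ∑ i, D.row hQ_diag hQ_symm (a i) := by
  refine LinearMap.ext fun F => ?_
  simp [row, LinearMap.sum_apply]

/-- The identity permutation has color vector $c$, so evaluation there sees only the component of
$f$ at $c$. -/
theorem row_coeffHecke_mul (f : (Fin n → I) → MvPolynomial (Fin n) k) (a : Hecke n Q) :
    D.row hQ_diag hQ_symm (coeffHecke n Q f * a) = aeval D.y (f c) • D.row hQ_diag hQ_symm a := by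
  refine LinearMap.ext fun F => ?_
  have h : ∀ v, (D.polyOp (f v) * D.eOp v) (D.rep hQ_diag hQ_symm a F) 1
      = if c = v then aeval D.y (f v) * D.rep hQ_diag hQ_symm a F 1 else 0 := by
    intro v
    change aeval (fun a => D.y a) (f v) * ((if c = v then 1 else 0) * _) = _
    split_ifs <;> simp
  have hrep : D.rep hQ_diag hQ_symm (coeffHecke n Q f) = ∑ v, D.polyOp (f v) * D.eOp v := by
    simp only [coeffHecke_apply, coeffPre_apply, map_sum, map_mul, rep_ePre, rep_polyPre]
  change D.rep hQ_diag hQ_symm (coeffHecke n Q f * a) F 1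
    = aeval D.y (f c) * D.rep hQ_diag hQ_symm a F 1
  rw [map_mul, hrep, Module.End.mul_apply, LinearMap.sum_apply, Finset.sum_apply]
  simp only [h]
  simp

/-- Starting from evaluation at 1, composing with $\tau_i$ passes from $h$ to $hs_i$: the unit
$\alpha$ can be divided out after the $\beta$ term is subtracted. -/
theorem proj_mem_span_row (hα : ∀ p q, p ≠ q → IsUnit (D.α p q)) (h : Equiv.Perm (Fin n)) :
    (LinearMap.proj h : Module.Dual K (Equiv.Perm (Fin n) → K)) ∈
      Submodule.span K (Set.range (D.row hQ_diag hQ_symm)) := by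
  set S := Submodule.span K (Set.range (D.row hQ_diag hQ_symm)) with hS
  have hmul : ∀ (b : Hecke n Q) (y), y ∈ S → y ∘ₗ D.rep hQ_diag hQ_symm b ∈ S := by
    intro b y hy
    induction hy using Submodule.span_induction with
    | mem y hy =>
      obtain ⟨a, rfl⟩ := hy
      exact Submodule.subset_span ⟨a * b, D.row_mul hQ_diag hQ_symm a b⟩
    | zero => rw [LinearMap.zero_comp]; exact zero_mem _
    | add x y _ _ hx hy => rw [LinearMap.add_comp]; exact add_mem hx hy
    | smul r x _ hx => rw [LinearMap.smul_comp]; exact S.smul_mem _ hx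
  have hh : h ∈ Submonoid.closure (Set.range (sperm : Fin (n - 1) → Equiv.Perm (Fin n))) := by
    rw [closure_sperm]; exact Submonoid.mem_top h
  induction hh using Submonoid.closure_induction_right with
  | one =>
    refine Submodule.subset_span ⟨1, ?_⟩
    rw [row, map_one]
    rfl
  | mul_right h _ s hs ih =>
    obtain ⟨i, rfl⟩ := hs
    have hu := hα _ _ (h.injective.ne (lo_ne_hi i))
    have h1 := hmul (canonicalMap n Q (τPre Q i)) _ ih
    rw [rep_τPre] at h1
    have h2 : (LinearMap.proj (h * sperm i) : Module.Dual K (Equiv.Perm (Fin n) → K))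
        = Ring.inverse (D.α (h (lo i)) (h (hi i))) •
          (LinearMap.proj h ∘ₗ D.τOp i - D.β (h (lo i)) (h (hi i)) • LinearMap.proj h) := by
      refine LinearMap.ext fun F => ?_
      change F (h * sperm i) = Ring.inverse (D.α (h (lo i)) (h (hi i))) *
        (D.τOp i F h - D.β (h (lo i)) (h (hi i)) * F h)
      rw [τOp_apply, add_sub_cancel_right, ← mul_assoc, Ring.inverse_mul_cancel _ hu, one_mul]
    rw [h2]
    exact S.smul_mem _ (sub_mem h1 (S.smul_mem _ ih))

/-- The rows of the $n!$ given elements span the dual, which is free of rank $n!$. A spanning family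
of that size is independent over any nontrivial commutative ring $K$. -/
theorem linearIndependent_row [Nontrivial K] (hα : ∀ p q, p ≠ q → IsUnit (D.α p q))
    {W : Type*} [Fintype W] (hW : Fintype.card W = n.factorial) (b : W → Hecke n Q)
    (hb : ∀ a, a ∈ Submodule.span (coeffHecke n Q).range (Set.range b)) :
    LinearIndependent K fun i => D.row hQ_diag hQ_symm (b i) := by
  refine linearIndependent_of_top_le_span_of_card_eq_finrank (fun φ _ => ?_) ?_
  · have hrow : Submodule.span K (Set.range (D.row hQ_diag hQ_symm))
        ≤ Submodule.span K (Set.range fun i => D.row hQ_diag hQ_symm (b i)) := by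
      rw [Submodule.span_le]
      rintro _ ⟨a, rfl⟩
      obtain ⟨r, rfl⟩ := (Submodule.mem_span_range_iff_exists_fun _).1 (hb a)
      rw [SetLike.mem_coe, row_sum]
      refine sum_mem fun i _ => ?_
      obtain ⟨f, hf⟩ := (r i).2
      rw [Subring.smul_def, smul_eq_mul, ← hf, row_coeffHecke_mul]
      exact Submodule.smul_mem _ _ (Submodule.subset_span ⟨i, rfl⟩)
    have hφ : φ = ∑ h, φ (Pi.single h 1) • LinearMap.proj h := by
      refine LinearMap.pi_ext' fun h => LinearMap.ext_ring ?_
      simp [Pi.single_apply]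
    rw [hφ]
    exact sum_mem fun h _ => Submodule.smul_mem _ _
      (hrow (D.proj_mem_span_row hQ_diag hQ_symm hα h))
  · rw [hW]
    change _ = Module.finrank K ((Equiv.Perm (Fin n) → K) →ₗ[K] K)
    rw [Module.finrank_linearMap]
    simp [Fintype.card_perm]

end WeightData

/-- The quiver Hecke algebra has no polynomial torsion. -/
theorem eq_zero_of_polyPre_mul_eq_zero (hQ_diag : ∀ i, Q i i = 0)
    (hQ_regular : ∀ i j, i ≠ j → Q i j ∈ nonZeroDivisors (MvPolynomial (Fin 2) k))
    (hQ_symm : ∀ i j, Q i j = rename (Equiv.swap (0 : Fin 2) 1) (Q j i))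
    {f : MvPolynomial (Fin n) k} (hf : f ∈ nonZeroDivisors (MvPolynomial (Fin n) k))
    {a : Hecke n Q} (ha : canonicalMap n Q (polyPre Q f) * a = 0) : a = 0 := by
  -- The zero ring is set apart, since the rank argument needs nontrivial $K$.
  rcases subsingleton_or_nontrivial (MvPolynomial (Fin n) k) with h | h
  · rwa [Subsingleton.elim f 1, map_one, map_one, one_mul] at ha
  obtain ⟨W, _, b, hW, hb⟩ := (isHeckeLike (n := n) (Q := Q)).exists_spanning (n - 1)
  have hW' : Fintype.card W = n.factorial := by rw [hW]; cases n <;> rfl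
  have hb' := fun a => hb a (mem_level_hecke a)
  obtain ⟨r, rfl⟩ := (Submodule.mem_span_range_iff_exists_fun _).1 (hb' a)
  choose F hF using fun i => (r i).2
  have hr : ∀ i, r i • b i = coeffHecke n Q (F i) * b i := fun i => by
    rw [hF, Subring.smul_def, smul_eq_mul]
  have hfa : ∑ i, coeffHecke n Q ((fun _ => f) * F i) * b i = 0 := by
    rw [← ha, Finset.mul_sum]
    refine Finset.sum_congr rfl fun i _ => ?_
    rw [hr, map_mul, coeffHecke_apply Q (fun _ => f), coeffPre_const, mul_assoc]
  have hF0 : ∀ i v, F i v = 0 := by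
    intro i v
    -- Choosing the color vector $v$ makes the rows detect exactly the components `F i v`.
    let D := genericData hQ_diag hQ_symm v
    have hi := D.linearIndependent_row hQ_diag hQ_symm (fun p q => isUnit_genericα hQ_regular v)
      hW' b hb'
    have hs := congrArg (D.row hQ_diag hQ_symm) hfa
    rw [WeightData.row_sum, WeightData.row, map_zero, LinearMap.comp_zero] at hs
    simp only [WeightData.row_coeffHecke_mul] at hs
    have h0 := Fintype.linearIndependent_iff.1 hi _ hs i
    have hy : aeval D.y (f * F i v) = algebraMap _ (TotalFraction k n) (f * F i v) := by
      change aeval (algebraMap _ (TotalFraction k n) ∘ X) _ = _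
      rw [aeval_algebraMap_apply, aeval_X_left_apply]
    have h1 : f * F i v = 0 :=
      IsFractionRing.injective _ (TotalFraction k n) (by rw [map_zero, ← hy]; exact h0)
    exact mem_nonZeroDivisors_iff_right.1 hf _ (by rwa [mul_comm])
  refine Finset.sum_eq_zero fun i _ => ?_
  rw [hr, show F i = 0 from funext (hF0 i), map_zero, zero_mul]

end Row

/-! ### Comparison of the two algebras -/

section Comparison

variable {k : Type u} [CommRing k] {I : Type w} [Fintype I] [DecidableEq I] {n : ℕ}
  {Q : I → I → MvPolynomial (Fin 2) k}
  (hQ_regular : ∀ i j, i ≠ j → Q i j ∈ nonZeroDivisors (MvPolynomial (Fin 2) k))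
  (hQ_symm : ∀ i j, Q i j = rename (Equiv.swap (0 : Fin 2) 1) (Q j i))

/-- The morphism from the quiver Hecke algebra to the torsion-free quotient of `H'_n(Q)`. -/
def heckeToQuotient : Hecke n Q →ₐ[k] (torsionIdeal n Q).ringCon.Quotient :=
  Presented.lift ((RingCon.mkₐ k (torsionIdeal n Q).ringCon).comp (mkPre n Q)) (by
    rintro _ _ (hab | ⟨i, j, hij, v, hv, hv'⟩)
    · rw [AlgHom.comp_apply, AlgHom.comp_apply]
      exact congrArg _ (Presented.mk_rel hab)
    · rw [AlgHom.comp_apply, map_zero, ← map_zero (RingCon.mkₐ k (torsionIdeal n Q).ringCon)]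
      exact (RingCon.eq _).2 ((TwoSidedIdeal.mem_iff _ _).1 ((mem_torsionIdeal _).2
        (isPolyTorsion_cubicDefect hQ_regular hQ_symm hij hv hv'))))

theorem heckeToQuotient_canonicalMap (a : HeckePre n Q) :
    heckeToQuotient hQ_regular hQ_symm (canonicalMap n Q a)
      = (a : (torsionIdeal n Q).ringCon.Quotient) := by
  obtain ⟨a, rfl⟩ := Presented.mk_surjective (k := k) a
  change heckeToQuotient hQ_regular hQ_symm (canonicalMap n Q (mkPre n Q a)) = _
  rw [canonicalMap_mkPre]
  exact Presented.lift_mk _ _ a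

/-- The kernel of the canonical morphism is the polynomial torsion. -/
theorem canonicalMap_eq_zero_iff (hQ_diag : ∀ i, Q i i = 0)
    (hQ_regular : ∀ i j, i ≠ j → Q i j ∈ nonZeroDivisors (MvPolynomial (Fin 2) k))
    (hQ_symm : ∀ i j, Q i j = rename (Equiv.swap (0 : Fin 2) 1) (Q j i)) (a : HeckePre n Q) :
    canonicalMap n Q a = 0 ↔ IsPolyTorsion Q a := by
  constructor
  · intro ha
    have h := heckeToQuotient_canonicalMap hQ_regular hQ_symm a
    rw [ha, map_zero] at h
    exact (mem_torsionIdeal a).1 ((TwoSidedIdeal.mem_iff _ _).2 ((RingCon.eq _).1 h.symm))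
  · rintro ⟨f, hf, ha⟩
    exact eq_zero_of_polyPre_mul_eq_zero hQ_diag hQ_regular hQ_symm hf
      (by rw [← map_mul, ha, map_zero])

theorem heckeToQuotient_bijective (hQ_diag : ∀ i, Q i i = 0) :
    Function.Bijective (heckeToQuotient (n := n) hQ_regular hQ_symm) := by
  constructor
  · rw [injective_iff_map_eq_zero]
    intro a ha
    obtain ⟨a, rfl⟩ := canonicalMap_surjective a
    rw [heckeToQuotient_canonicalMap] at ha
    exact (canonicalMap_eq_zero_iff hQ_diag hQ_regular hQ_symm a).2 ((mem_torsionIdeal a).1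
      ((TwoSidedIdeal.mem_iff _ _).2 ((RingCon.eq _).1 ha)))
  · intro a
    obtain ⟨a, rfl⟩ := RingCon.mk'_surjective _ a
    exact ⟨_, heckeToQuotient_canonicalMap hQ_regular hQ_symm a⟩

end Comparison

end QuiverHecke
end

theorem mainTheorem10 {k : Type*} [CommRing k] {I : Type*} [Fintype I] [DecidableEq I]
    (n : ℕ) (Q : I → I → MvPolynomial (Fin 2) k)
    (hQ_diag : ∀ i, Q i i = 0)
    (hQ_regular : ∀ i j, i ≠ j → Q i j ∈ nonZeroDivisors (MvPolynomial (Fin 2) k))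
    (hQ_symm : ∀ i j, Q i j = MvPolynomial.rename (Equiv.swap (0 : Fin 2) 1) (Q j i)) :
    -- the canonical morphism is onto, and its kernel is the polynomial torsion
    Function.Surjective (QuiverHecke.canonicalMap n Q) ∧
    (∀ a : QuiverHecke.HeckePre n Q,
      a ∈ RingHom.ker (QuiverHecke.canonicalMap n Q) ↔
        QuiverHecke.IsPolyTorsion Q a) ∧
    -- the cubic relation holds modulo torsion as soon as the other relations hold
    (∀ (i j : Fin (n - 1)) (v : Fin n → I), j.val = i.val + 1 →
      v (QuiverHecke.lo i) = v (QuiverHecke.hi j) → v (QuiverHecke.hi i) ≠ v (QuiverHecke.lo i) →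
      QuiverHecke.IsPolyTorsion Q (QuiverHecke.mkPre n Q (QuiverHecke.cubicDefect Q i j v))) ∧
    -- the torsion is a two-sided ideal, and the quotient by it is the quiver Hecke algebra
    (∃ J : TwoSidedIdeal (QuiverHecke.HeckePre n Q),
      (∀ a, a ∈ J ↔ QuiverHecke.IsPolyTorsion Q a) ∧
      ∃ φ : J.ringCon.Quotient ≃ₐ[k] QuiverHecke.Hecke n Q,
        ∀ a : QuiverHecke.HeckePre n Q,
          φ (a : J.ringCon.Quotient) = QuiverHecke.canonicalMap n Q a) := by
  refine ⟨QuiverHecke.canonicalMap_surjective, fun a => ?_, fun i j v hij hv hv' =>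
    QuiverHecke.isPolyTorsion_cubicDefect hQ_regular hQ_symm hij hv hv',
    QuiverHecke.torsionIdeal n Q, QuiverHecke.mem_torsionIdeal,
    (AlgEquiv.ofBijective _
      (QuiverHecke.heckeToQuotient_bijective hQ_regular hQ_symm hQ_diag)).symm, fun a => ?_⟩
  · exact RingHom.mem_ker.trans
      (QuiverHecke.canonicalMap_eq_zero_iff hQ_diag hQ_regular hQ_symm a)
  · rw [AlgEquiv.symm_apply_eq]
    exact (QuiverHecke.heckeToQuotient_canonicalMap hQ_regular hQ_symm a).symm
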